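/- **Setting.** For a symmetric matrix $\Theta=(\theta_{ij})\in\mathbb R^{d\times d}$ with zero diagonal, the zero-field Ising model on $\{\pm1\}^d$ is $\mathbb P_\Theta(x)=Z_\Theta^{-1}\exp\big(\sum_{i,j=1}^d\theta_{ij}x_ix_j\big)$ (sum over all ordered pairs), and $\mathbb P_{\Theta,n}$ is the law of $n$ independent observations from it. $G(\Theta)$ is the graph on $\{1,\dots,d\}$ whose edges are the pairs with $\theta_{ij}\neq0$. For a class $\mathcal G_1$ of graphs on $\{1,\dots,d\}$ not containing the empty graph, and $\theta>0$, let $$\mathcal S(\mathcal G_1,\theta)=\Big\{\Theta=\Theta^T:\ \mathrm{diag}\,\Theta=0,\ G(\Theta)\in\mathcal G_1,\ \|\Theta\|_F\le\tfrac12,\ \min_{(i,j)\in E(G(\Theta))}\theta_{ij}\ge\theta\Big\}.$$ The minimax risk of testing $\Theta=0$ against $\Theta\in\mathcal S$ is $$\gamma(\mathcal S)=\inf_\psi\Big[\mathbb P_{0,n}(\psi=1)+\sup_{\Theta\in\mathcal S}\mathbb P_{\Theta,n}(\psi=0)\Big],$$ the infimum being over all tests $\psi$ with values in $\{0,1\}$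 based on $n$ observations. For a graph $G$, let $V(G)$ be its set of non-isolated vertices, $A_G$ its adjacency matrix, and $\mathcal R(G)=\big\lceil\max_{|V|\ge2}|E(G_V)|/(|V|-1)\big\rceil$ its arboricity, where $G_V$ is the restriction of $G$ to the vertex set $V$. Let $\mathcal G^*\subseteq\mathcal G_1$ be non-empty, let $G'$ be uniformly distributed on $\mathcal G^*$, and put $$N(\mathcal G^*)=\max_{G\in\mathcal G^*}\mathbb E\,|V(G)\cap V(G')|,\quad \mathcal R=\max_{G\in\mathcal G^*}\mathcal R(G),\quad \Lambda=\max_{G\in\mathcal G^*}\|A_G\|_F,\quad \Gamma=\max_{G\in\mathcal G^*}\|A_G\|_1,$$ $$\mathcal B=\big(512\,\Lambda^4\big)\wedge\Big(160\,(\Lambda\vee\Gamma)^2\max_{G\in\mathcal G^*}|V(G)|\Big),\qquad \mathcal S^*=\{\theta A_G:G\in\mathcal G^*\},$$ where $\|A\|_1=\max_{\|v\|_1=1}\|Av\|_1$. The set $\mathcal G^*$ is *incoherent* if for every fixed $G\in\mathcal G^*$ the binary variables $\{\mathbf 1[v\in V(G')]\}_{v\in V(G)}$ are negatively associated: for disjoint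 $I,J\subseteq V(G)$ and coordinatewise nondecreasing $f,g$, the covariance of $f\big((\mathbf 1[v\in V(G')])_{v\in I}\big)$ and $g\big((\mathbf 1[v\in V(G')])_{v\in J}\big)$ is at most $0$. **Theorem.** Let $d=d_n$, $\mathcal G_1=\mathcal G_{1,n}$, $\mathcal G^*=\mathcal G^*_n$ and $\theta=\theta_n>0$ depend on the sample size $n$ as above, with $\mathcal G^*$ incoherent for all large $n$ and $N(\mathcal G^*)=o(1)$. If, for all large $n$, $$\theta\le\frac1{8(\Lambda\vee\Gamma)},\qquad \theta\le\sqrt{\frac{\mathcal R}{\mathcal B}},\qquad \theta\le\sqrt{\frac{\log(1/N(\mathcal G^*))}{6n\mathcal R}},$$ then, as $n\to\infty$, $$\gamma\big(\mathcal S(\mathcal G_1,\theta)\big)\to1\qquad\text{and}\qquad\gamma(\mathcal S^*)\to1 .$$ -/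

import Mathlib

open Filter Topology

namespace IsingDetection

noncomputable section

open scoped Classical in
/-- The set `V(G)` of non-isolated vertices of a graph `G` on the vertex set `Fin d`. -/
def vert {d : ℕ} (G : SimpleGraph (Fin d)) : Finset (Fin d) :=
  Finset.univ.filter fun i => ∃ j, G.Adj i j

open scoped Classical in
/-- The adjacency matrix `A_G`. -/
def adj {d : ℕ} (G : SimpleGraph (Fin d)) : Matrix (Fin d) (Fin d) ℝ :=
  G.adjMatrix ℝ

/-- The Frobenius norm of a square matrix. -/
def frob {d : ℕ} (A : Matrix (Fin d) (Fin d) ℝ) : ℝ :=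
  Real.sqrt (∑ i, ∑ j, A i j ^ 2)

/-- The matrix norm `‖A‖₁ = max {‖A v‖₁ : ‖v‖₁ = 1}`. -/
def opNormOne {d : ℕ} (A : Matrix (Fin d) (Fin d) ℝ) : ℝ :=
  ⨆ v : {v : Fin d → ℝ // ∑ i, |v i| = 1}, ∑ i, |(A.mulVec v.1) i|

/-- The number `|E(G_V)|` of edges of `G` with both endpoints in `V`. -/
def edgesWithin {d : ℕ} (G : SimpleGraph (Fin d)) (V : Finset (Fin d)) : ℕ :=
  Set.ncard {e : Sym2 (Fin d) | e ∈ G.edgeSet ∧ ∀ v ∈ e, v ∈ V}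

/-- The arboricity `⌈max_V |E(G_V)| / (|V| - 1)⌉`, over vertex sets `V` with at least two
elements. -/
def arboricity {d : ℕ} (G : SimpleGraph (Fin d)) : ℕ :=
  ⌈⨆ V : {V : Finset (Fin d) // 2 ≤ V.card},
    (edgesWithin G V.1 : ℝ) / ((V.1.card : ℝ) - 1)⌉₊

/-! ### The zero-field Ising model -/

/-- A spin configuration in `{-1, 1}^d`. -/
abbrev Config (d : ℕ) : Type := Fin d → ℤˣ

/-- The spin `x i`, as a real number `-1` or `1`. -/
def spin {d : ℕ} (x : Config d) (i : Fin d) : ℝ := ((x i : ℤ) : ℝ)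

/-- The unnormalised weight `exp (∑_{i,j} Θ_{ij} x_i x_j)`; the sum runs over all ordered pairs. -/
def weight {d : ℕ} (Θ : Matrix (Fin d) (Fin d) ℝ) (x : Config d) : ℝ :=
  Real.exp (∑ i, ∑ j, Θ i j * spin x i * spin x j)

/-- The partition function. -/
def partition {d : ℕ} (Θ : Matrix (Fin d) (Fin d) ℝ) : ℝ := ∑ x : Config d, weight Θ x

/-- The probability mass function of the zero-field Ising model with interaction matrix `Θ`. -/
def pmf {d : ℕ} (Θ : Matrix (Fin d) (Fin d) ℝ) (x : Config d) : ℝ := weight Θ x / partition Θ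

/-- The joint law of `n` independent observations: the probability of an event `T`. -/
def prob {d : ℕ} (n : ℕ) (Θ : Matrix (Fin d) (Fin d) ℝ) (T : Set (Fin n → Config d)) : ℝ :=
  ∑ X : Fin n → Config d, T.indicator (fun X => ∏ l, pmf Θ (X l)) X

/-- The graph whose edges are the pairs with non-zero interaction (for symmetric `Θ`). -/
def graphOf {d : ℕ} (Θ : Matrix (Fin d) (Fin d) ℝ) : SimpleGraph (Fin d) :=
  SimpleGraph.fromRel fun i j => Θ i j ≠ 0

/-- The parameter space `S(𝒢₁, θ)`: symmetric interaction matrices with zero diagonal whose graph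
is in `𝒢₁`, with Frobenius norm at most `1/2` and all interactions along edges at least `θ`. -/
def paramSpace {d : ℕ} (G₁ : Set (SimpleGraph (Fin d))) (θ : ℝ) :
    Set (Matrix (Fin d) (Fin d) ℝ) :=
  {Θ | Θ.IsSymm ∧ (∀ i, Θ i i = 0) ∧ graphOf Θ ∈ G₁ ∧ frob Θ ≤ 1 / 2 ∧
    ∀ i j, (graphOf Θ).Adj i j → θ ≤ Θ i j}

/-- The simple models `S* = {θ A_G : G ∈ 𝒢*}`. -/
def simpleSpace {d : ℕ} (Gs : Finset (SimpleGraph (Fin d))) (θ : ℝ) :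
    Set (Matrix (Fin d) (Fin d) ℝ) :=
  {Θ | ∃ G ∈ Gs, Θ = θ • adj G}

/-- The minimax risk `inf_ψ [P_{0,n}(ψ = 1) + sup_{Θ ∈ S} P_{Θ,n}(ψ = 0)]` of testing `Θ = 0`
against `Θ ∈ S` from `n` observations; the infimum is over all tests. -/
def risk {d : ℕ} (n : ℕ) (S : Set (Matrix (Fin d) (Fin d) ℝ)) : ℝ :=
  ⨅ ψ : (Fin n → Config d) → Bool,
    (prob n 0 {X | ψ X = true} + ⨆ Θ : S, prob n Θ.1 {X | ψ X = false})

/-! ### Quantities attached to a finite class `𝒢*` of graphs -/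

/-- The expectation of `φ(G')` for `G'` uniformly distributed on `𝒢*`. -/
def unifExp {d : ℕ} (Gs : Finset (SimpleGraph (Fin d))) (φ : SimpleGraph (Fin d) → ℝ) : ℝ :=
  (∑ G ∈ Gs, φ G) / (Gs.card : ℝ)

open scoped Classical in
/-- The binary variable `1[v ∈ V(G')]`. -/
def ind {d : ℕ} (v : Fin d) (G : SimpleGraph (Fin d)) : ℝ := if v ∈ vert G then 1 else 0

/-- `𝒢*` is incoherent: for every fixed `G ∈ 𝒢*`, the variables `1[v ∈ V(G')]`, `v ∈ V(G)`, with
`G'` uniform on `𝒢*`, are negatively associated, that is, coordinatewise nondecreasing functions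
of two disjoint subfamilies have nonpositive covariance. -/
def Incoherent {d : ℕ} (Gs : Finset (SimpleGraph (Fin d))) : Prop :=
  ∀ G ∈ Gs, ∀ I J : Finset (Fin d), I ⊆ vert G → J ⊆ vert G → Disjoint I J →
    ∀ (f : (I → ℝ) → ℝ) (g : (J → ℝ) → ℝ), Monotone f → Monotone g →
      unifExp Gs (fun G' => f (fun v => ind v.1 G') * g (fun v => ind v.1 G')) ≤
        unifExp Gs (fun G' => f (fun v => ind v.1 G')) *
          unifExp Gs (fun G' => g (fun v => ind v.1 G'))

/-- `N(𝒢*) = max_{G ∈ 𝒢*} E |V(G) ∩ V(G')|`, with `G'` uniform on `𝒢*`. -/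
def overlap {d : ℕ} (Gs : Finset (SimpleGraph (Fin d))) : ℝ :=
  ⨆ G : Gs, unifExp Gs (fun G' => ((vert G.1 ∩ vert G').card : ℝ))

/-- `𝓡 = max_{G ∈ 𝒢*} 𝓡(G)`. -/
def maxArboricity {d : ℕ} (Gs : Finset (SimpleGraph (Fin d))) : ℕ := Gs.sup arboricity

/-- `Λ = max_{G ∈ 𝒢*} ‖A_G‖_F`. -/
def Lam {d : ℕ} (Gs : Finset (SimpleGraph (Fin d))) : ℝ := ⨆ G : Gs, frob (adj G.1)

/-- `Γ = max_{G ∈ 𝒢*} ‖A_G‖₁`. -/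
def Gam {d : ℕ} (Gs : Finset (SimpleGraph (Fin d))) : ℝ := ⨆ G : Gs, opNormOne (adj G.1)

/-- `max_{G ∈ 𝒢*} |V(G)|`. -/
def maxVert {d : ℕ} (Gs : Finset (SimpleGraph (Fin d))) : ℕ := Gs.sup fun G => (vert G).card

/-- `𝓑 = (512 Λ⁴) ∧ (160 (Λ ∨ Γ)² max_{G ∈ 𝒢*} |V(G)|)`. -/
def Bq {d : ℕ} (Gs : Finset (SimpleGraph (Fin d))) : ℝ :=
  min (512 * Lam Gs ^ 4) (160 * max (Lam Gs) (Gam Gs) ^ 2 * (maxVert Gs : ℝ))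

end

end IsingDetection

open IsingDetection

/-! The risk is at most 1 because a test may always accept the null. For the lower bound, the
supremum over the alternative is replaced by the average over `θ • adj G` with `G` uniform on 𝒢*. By
Cauchy–Schwarz the risk is then at least 1 − √χ², where 1 + χ² is the average over pairs of (2^d Σ_x
p_G p_G')^n (`card_mul_sum_sq_mixture`, `one_sub_sqrt_le_risk`).

The high-temperature expansion turns 2^d Σ_x p_G p_G' into a ratio of generating functions in t =
tanh 2θ: even edge sets of the two-coloured multigraph G ⊔ G', divided by those of G times those of
G'. Even sets split into monochromatic even sets and bichromatic circuits, so the ratio is at most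
exp Σ_C t^|C| over bichromatic circuits C (`evenSum_le`, `sum_pmf_mul_pmf_le`). Each C splits at two
vertices i < j of S = V(G) ∩ V(G') into acyclic trails, one with G-edges and one with G'-edges at
its ends (`IsCirc.exists_split`).

The trail matrix w satisfies w ≤ 1 + t w (A_G + A_G') entrywise. As tΛ and tΓ are at most 1/4, this
inequality controls A w A by absorption. The trails with ends of one colour are dominated by tA + t²
A w A; the condition θ²𝓑 ≤ 𝓡 keeps the second term small, and the first counts edges inside S, at
most 𝓡|S| of them. So the circuit sum is at most 5.99 θ²𝓡|S| (`sum_mixedCircuits_pairEdges_le`).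

Negative association bounds the exponential moment of |S| as if its indicators were independent: E
exp(c|S|) ≤ exp(e^c N). With c = 5.99 nθ²𝓡 and 6nθ²𝓡 ≤ log(1/N) this is at most exp(N^{1/600}),
which tends to 1. -/

set_option linter.unusedSectionVars false

namespace IsingDetection

/-! ### Even edge sets of a multigraph -/

section Multigraph

variable {V α : Type*} [DecidableEq α]

/-- The product of the signs of the two endpoints of an edge. -/
def edgeSign (x : V → ℤˣ) : Sym2 V → ℤˣ :=
  Sym2.lift ⟨fun i j => x i * x j, fun _ _ => mul_comm _ _⟩

@[simp] lemma edgeSign_mk (x : V → ℤˣ) (i j : V) : edgeSign x s(i, j) = x i * x j := rfl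

lemma edgeSign_mul (x y : V → ℤˣ) (e : Sym2 V) :
    edgeSign (x * y) e = edgeSign x e * edgeSign y e := by
  induction e with
  | _ i j => simp [mul_mul_mul_comm]

/-- The product of the signs of the edges in `H`. -/
def flow (σ : α → Sym2 V) (H : Finset α) (x : V → ℤˣ) : ℤˣ := ∏ a ∈ H, edgeSign x (σ a)

/-- `H` has even degree everywhere except at the two ends `i` and `j` of a trail. -/
def IsJoin (σ : α → Sym2 V) (H : Finset α) (i j : V) : Prop := ∀ x, flow σ H x = x i * x j

/-- All degrees of `H` are even. -/
def IsEven (σ : α → Sym2 V) (H : Finset α) : Prop := ∀ x, flow σ H x = 1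

/-- `H` contains no nonempty even set. -/
def IsAcyc (σ : α → Sym2 V) (H : Finset α) : Prop := ∀ K ⊆ H, IsEven σ K → K = ∅

/-- A minimal nonempty even set. -/
def IsCirc (σ : α → Sym2 V) (H : Finset α) : Prop :=
  H.Nonempty ∧ IsEven σ H ∧ ∀ K ⊆ H, IsEven σ K → K.Nonempty → K = H

variable {σ : α → Sym2 V} {H K : Finset α} {i j l : V}

/-- Each edge set gives a character of {±1}^V. Evenness is triviality of this character, so it can
be tested on generators and detected by orthogonality. -/
lemma flow_mul (x y : V → ℤˣ) : flow σ H (x * y) = flow σ H x * flow σ H y := by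
  simp [flow, edgeSign_mul, Finset.prod_mul_distrib]

lemma flow_sdiff (h : K ⊆ H) (x : V → ℤˣ) : flow σ (H \ K) x * flow σ K x = flow σ H x :=
  Finset.prod_sdiff h

lemma isJoin_self : IsJoin σ H i i ↔ IsEven σ H := by
  simp [IsJoin, IsEven, Int.units_mul_self]

lemma IsJoin.symm (h : IsJoin σ H i j) : IsJoin σ H j i := fun x => by rw [h x, mul_comm]

lemma isEven_empty : IsEven σ (∅ : Finset α) := fun x => by simp [flow]

lemma IsEven.sdiff (hH : IsEven σ H) (hK : IsEven σ K) (h : K ⊆ H) : IsEven σ (H \ K) := by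
  intro x
  have := flow_sdiff (σ := σ) h x
  rwa [hK x, hH x, mul_one] at this

lemma IsEven.sdiff_isJoin (hH : IsEven σ H) (hK : IsJoin σ K i j) (h : K ⊆ H) :
    IsJoin σ (H \ K) i j := by
  intro x
  have h1 := flow_sdiff (σ := σ) h x
  rw [hK x, hH x] at h1
  rw [eq_inv_of_mul_eq_one_left h1, Int.units_inv_eq_self]

lemma IsEven.disjUnion (hH : IsEven σ H) (hK : IsEven σ K) (h : Disjoint H K) :
    IsEven σ (H ∪ K) := by
  intro x
  rw [flow, Finset.prod_union h]
  exact (congrArg₂ (· * ·) (hH x) (hK x)).trans (one_mul 1)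

/-- Removing an edge at an end moves that end along the edge, because the sign at `i` cancels. -/
lemma IsJoin.erase {a : α} (h : IsJoin σ H i j) (ha : a ∈ H) (hl : σ a = s(i, l)) :
    IsJoin σ (H.erase a) l j := by
  intro x
  have h1 : edgeSign x (σ a) * flow σ (H.erase a) x = flow σ H x :=
    Finset.mul_prod_erase H (fun a => edgeSign x (σ a)) ha
  rw [h x, hl, edgeSign_mk, mul_assoc, mul_left_cancel_iff] at h1
  rw [← h1, ← mul_assoc, Int.units_mul_self, one_mul]

lemma IsJoin.insert {a : α} (h : IsJoin σ H i j) (ha : a ∉ H) (hl : σ a = s(j, l)) :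
    IsJoin σ (insert a H) i l := by
  intro x
  have h1 : flow σ (Insert.insert a H) x = edgeSign x (σ a) * flow σ H x :=
    Finset.prod_insert ha
  rw [h1, h x, hl, edgeSign_mk, mul_comm (x i), mul_comm (x j) (x l), mul_assoc,
    ← mul_assoc (x j), Int.units_mul_self, one_mul, mul_comm]

lemma IsAcyc.mono (h : IsAcyc σ H) (hK : K ⊆ H) : IsAcyc σ K :=
  fun L hL hE => h L (hL.trans hK) hE

variable [DecidableEq V]

/-- The configuration with a single negative spin. -/
def flip (i : V) : V → ℤˣ := Function.update 1 i (-1)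

/-- Flipping one spin reads off the parity of the degree at that vertex; loops are excluded because
their sign is always 1. -/
lemma edgeSign_flip {e : Sym2 V} (he : ¬ e.IsDiag) (i : V) :
    edgeSign (flip i) e = if i ∈ e then -1 else 1 := by
  induction e with
  | _ p q =>
    simp only [Sym2.mk_isDiag_iff] at he
    simp only [edgeSign_mk, flip, Sym2.mem_iff, Function.update_apply, Pi.one_apply]
    by_cases h1 : p = i <;> by_cases h2 : q = i
    · exact absurd (h1.trans h2.symm) he
    · simp [h1, Ne.symm h2, h2]
    · simp [h2, h1]
    · simp [h1, h2, Ne.symm h1, Ne.symm h2]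

lemma flow_flip_of_forall (hσ : ∀ a ∈ H, ¬ (σ a).IsDiag) (h : ∀ a ∈ H, i ∉ σ a) :
    flow σ H (flip i) = 1 := by
  refine Finset.prod_eq_one fun a ha => ?_
  rw [edgeSign_flip (hσ a ha), if_neg (h a ha)]

lemma IsJoin.flow_flip_left (h : IsJoin σ H i j) (hij : i ≠ j) : flow σ H (flip i) = -1 := by
  rw [h]; simp [flip, hij.symm]

lemma exists_mem_of_flow_flip (hσ : ∀ a ∈ H, ¬ (σ a).IsDiag) (h : flow σ H (flip i) ≠ 1) :
    ∃ a ∈ H, ∃ l, σ a = s(i, l) := by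
  by_contra! hc
  refine h (flow_flip_of_forall hσ fun a ha hi => ?_)
  obtain ⟨l, hl⟩ := hi
  exact hc a ha l hl

end Multigraph

/-! ### Generating functions of trails -/

/-- A choice of codes is injective because `φ` decodes it. Only existence of a decomposition is
needed to bound a generating function; uniqueness is not. -/
lemma sum_le_sum_of_cover {ι κ : Type*} {s : Finset ι} {T : Finset κ} {f : ι → ℝ} {h : κ → ℝ}
    (φ : κ → ι) (hcov : ∀ p ∈ s, ∃ q ∈ T, φ q = p ∧ f p ≤ h q) (hh : ∀ q ∈ T, 0 ≤ h q) :
    ∑ p ∈ s, f p ≤ ∑ q ∈ T, h q := by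
  classical
  rcases s.eq_empty_or_nonempty with rfl | ⟨p₀, hp₀⟩
  · simpa using Finset.sum_nonneg hh
  have : Nonempty κ := ⟨(hcov p₀ hp₀).choose⟩
  choose! g hgT hgφ hgf using hcov
  have hinj : Set.InjOn g s := fun p hp q hq hpq => by
    rw [← hgφ p hp, ← hgφ q hq, hpq]
  calc ∑ p ∈ s, f p ≤ ∑ p ∈ s, h (g p) := Finset.sum_le_sum hgf
    _ = ∑ q ∈ s.image g, h q := (Finset.sum_image hinj).symm
    _ ≤ ∑ q ∈ T, h q := Finset.sum_le_sum_of_subset_of_nonneg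
        (Finset.image_subset_iff.2 hgT) fun q hq _ => hh q hq

section Multigraph

variable {V α : Type*} [DecidableEq α] [DecidableEq V] [Fintype V]

open scoped Classical in
/-- The acyclic trails in `D` from `i` to `j`, as edge sets. -/
noncomputable def joins (σ : α → Sym2 V) (D : Finset α) (i j : V) : Finset (Finset α) :=
  D.powerset.filter fun P => IsJoin σ P i j ∧ IsAcyc σ P

/-- The generating function of the acyclic trails in `D` from `i` to `j`. -/
noncomputable def pathSum (t : ℝ) (σ : α → Sym2 V) (D : Finset α) (i j : V) : ℝ :=
  ∑ P ∈ joins σ D i j, t ^ P.card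

/-- The number of edges in `D` between `i` and `j`. -/
def mult (σ : α → Sym2 V) (D : Finset α) (i j : V) : ℝ := ((D.filter fun a => σ a = s(i, j)).card : ℝ)

open scoped Classical in
/-- The acyclic trails in `D` from `i` to `j` that have edges from `E` at both ends. -/
noncomputable def endJoins (σ : α → Sym2 V) (D E : Finset α) (i j : V) : Finset (Finset α) :=
  (joins σ D i j).filter fun P => (∃ a ∈ P, a ∈ E ∧ i ∈ σ a) ∧ ∃ a ∈ P, a ∈ E ∧ j ∈ σ a

/-- The generating function of the acyclic trails in `D` from `i` to `j` that have edges from `E`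
at both ends. -/
noncomputable def endSum (t : ℝ) (σ : α → Sym2 V) (D E : Finset α) (i j : V) : ℝ :=
  ∑ P ∈ endJoins σ D E i j, t ^ P.card

variable {σ : α → Sym2 V} {D E P : Finset α} {i j : V} {t : ℝ}

lemma mem_joins : P ∈ joins σ D i j ↔ P ⊆ D ∧ IsJoin σ P i j ∧ IsAcyc σ P := by
  classical
  simp [joins]

lemma joins_comm : joins σ D i j = joins σ D j i := by
  ext P
  simp only [mem_joins]
  exact ⟨fun h => ⟨h.1, h.2.1.symm, h.2.2⟩, fun h => ⟨h.1, h.2.1.symm, h.2.2⟩⟩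

lemma pathSum_comm : pathSum t σ D i j = pathSum t σ D j i := by
  rw [pathSum, joins_comm, pathSum]

lemma pathSum_nonneg (ht : 0 ≤ t) : 0 ≤ pathSum t σ D i j :=
  Finset.sum_nonneg fun _ _ => pow_nonneg ht _

lemma mult_nonneg : 0 ≤ mult σ D i j := Nat.cast_nonneg _

lemma endSum_nonneg (ht : 0 ≤ t) : 0 ≤ endSum t σ D E i j :=
  Finset.sum_nonneg fun _ _ => pow_nonneg ht _

/-- Delete an edge at `j`; what remains is an acyclic trail to its other endpoint. When `i = j`,
acyclicity leaves only the empty trail. Adding an edge may create a cycle, so this is only an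
inequality. -/
lemma pathSum_le (ht : 0 ≤ t) (hσ : ∀ a ∈ D, ¬ (σ a).IsDiag) (i j : V) :
    pathSum t σ D i j ≤ (if i = j then 1 else 0) + t * ∑ l, pathSum t σ D i l * mult σ D l j := by
  classical
  have hnn : 0 ≤ t * ∑ l, pathSum t σ D i l * mult σ D l j :=
    mul_nonneg ht (Finset.sum_nonneg fun l _ => mul_nonneg (pathSum_nonneg ht) mult_nonneg)
  by_cases hij : i = j
  · subst hij
    have h1 : joins σ D i i ⊆ {∅} := fun P hP => by
      rw [mem_joins, isJoin_self] at hP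
      exact Finset.mem_singleton.2 (hP.2.2 P subset_rfl hP.2.1)
    have h2 : pathSum t σ D i i ≤ ∑ P ∈ ({∅} : Finset (Finset α)), t ^ P.card :=
      Finset.sum_le_sum_of_subset_of_nonneg h1 fun _ _ _ => pow_nonneg ht _
    simp only [Finset.sum_singleton, Finset.card_empty, pow_zero] at h2
    simp only [if_true]
    linarith
  · have h : t * ∑ l, pathSum t σ D i l * mult σ D l j =
        ∑ q ∈ Finset.univ.sigma fun l : V =>
          joins σ D i l ×ˢ D.filter fun a => σ a = s(l, j), t ^ (q.2.1.card + 1) := by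
      rw [Finset.sum_sigma, Finset.mul_sum]
      refine Finset.sum_congr rfl fun l _ => ?_
      rw [Finset.sum_product, pathSum, Finset.sum_mul, Finset.mul_sum]
      refine Finset.sum_congr rfl fun P _ => ?_
      simp only [Finset.sum_const, nsmul_eq_mul, mult]
      ring
    rw [if_neg hij, zero_add, h]
    refine sum_le_sum_of_cover (fun q => insert q.2.2 q.2.1) (fun P hP => ?_)
      fun q _ => pow_nonneg ht _
    obtain ⟨hPD, hJ, hA⟩ := mem_joins.1 hP
    obtain ⟨a, haP, l, hl⟩ := exists_mem_of_flow_flip (i := j) (fun a ha => hσ a (hPD ha))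
      (by rw [hJ.symm.flow_flip_left (Ne.symm hij)]; decide)
    refine ⟨⟨l, (P.erase a, a)⟩, ?_, Finset.insert_erase haP, ?_⟩
    · simp only [Finset.mem_sigma, Finset.mem_univ, Finset.mem_product, mem_joins, true_and,
        Finset.mem_filter]
      exact ⟨⟨(Finset.erase_subset _ _).trans hPD, (hJ.symm.erase haP hl).symm,
        hA.mono (Finset.erase_subset _ _)⟩, hPD haP, by rw [hl, Sym2.eq_swap]⟩
    · simp only
      rw [Finset.card_erase_add_one haP]

/-- Strip an `E`-edge at each end. If the two edges coincide, the trail is that single edge, which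
gives the first term. -/
lemma endSum_le (ht : 0 ≤ t) (hij : i ≠ j) :
    endSum t σ D E i j ≤ t * mult σ E i j +
      t ^ 2 * ∑ p, ∑ q, mult σ E i p * pathSum t σ D p q * mult σ E q j := by
  classical
  have h : t * mult σ E i j +
      t ^ 2 * ∑ p, ∑ q, mult σ E i p * pathSum t σ D p q * mult σ E q j =
        ∑ u ∈ (E.filter fun a => σ a = s(i, j)).disjSum
          (Finset.univ.sigma fun p : V × V => (E.filter fun a => σ a = s(i, p.1)) ×ˢ
            joins σ D p.1 p.2 ×ˢ E.filter fun a => σ a = s(p.2, j)),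
          Sum.elim (fun _ => t) (fun q => t ^ (q.2.2.1.card + 2)) u := by
    rw [Finset.sum_disjSum, Finset.sum_sigma, ← Finset.univ_product_univ, Finset.sum_product,
      Finset.mul_sum]
    congr 1
    · simp [mult, mul_comm]
    · refine Finset.sum_congr rfl fun p _ => ?_
      rw [Finset.mul_sum]
      refine Finset.sum_congr rfl fun q _ => ?_
      simp only [Finset.sum_product, Sum.elim_inr, Finset.sum_const, nsmul_eq_mul, mult, pathSum,
        Finset.sum_mul, Finset.mul_sum]
      refine Finset.sum_congr rfl fun P _ => ?_
      ring
  rw [h]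
  refine sum_le_sum_of_cover
    (Sum.elim (fun a => {a}) fun q => insert q.2.1 (insert q.2.2.2 q.2.2.1))
    (fun P hP => ?_) ?_
  · obtain ⟨hP, ⟨a, haP, haE, p, hp⟩, b, hbP, hbE, q, hq⟩ := Finset.mem_filter.1 hP
    obtain ⟨hPD, hJ, hA⟩ := mem_joins.1 hP
    have hJa := hJ.erase haP hp
    by_cases hab : a = b
    · subst hab
      have hpj : p = j := by
        rw [hp, Sym2.eq_iff] at hq
        rcases hq with h | h
        · exact absurd h.1 hij
        · exact h.2
      subst hpj
      have h0 := hA _ (Finset.erase_subset _ _) (isJoin_self.1 hJa)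
      have h1 : P = {a} := by rw [← Finset.insert_erase haP, h0]; rfl
      refine ⟨Sum.inl a, ?_, h1.symm, ?_⟩
      · simp [haE, hp]
      · simp [h1]
    · have hbP' : b ∈ P.erase a := Finset.mem_erase.2 ⟨Ne.symm hab, hbP⟩
      have hJb := (hJa.symm.erase hbP' hq).symm
      refine ⟨Sum.inr ⟨(p, q), a, (P.erase a).erase b, b⟩, ?_, ?_, ?_⟩
      · simp only [Finset.inr_mem_disjSum, Finset.mem_sigma, Finset.mem_univ, Finset.mem_product,
          mem_joins, true_and, Finset.mem_filter]
        exact ⟨⟨haE, hp⟩, ⟨((Finset.erase_subset _ _).trans (Finset.erase_subset _ _)).trans hPD,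
          hJb, hA.mono ((Finset.erase_subset _ _).trans (Finset.erase_subset _ _))⟩, hbE,
          by rw [hq, Sym2.eq_swap]⟩
      · simp only [Sum.elim_inr]
        rw [Finset.insert_erase hbP', Finset.insert_erase haP]
      · simp only [Sum.elim_inr]
        rw [← Finset.card_erase_add_one haP, ← Finset.card_erase_add_one hbP']
  · rintro (a | q) _
    · exact ht
    · exact pow_nonneg ht _

end Multigraph

/-! ### Bichromatic circuits -/

section Multigraph

variable {V α : Type*} [DecidableEq α]

open scoped Classical in
/-- The generating function of the even subsets of `D`. -/
noncomputable def evenSum (t : ℝ) (σ : α → Sym2 V) (D : Finset α) : ℝ :=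
  ∑ H ∈ D.powerset.filter (IsEven σ), t ^ H.card

/-- The edges of `D` with colour `b`. -/
def colored (col : α → Bool) (b : Bool) (D : Finset α) : Finset α := D.filter fun a => col a = b

open scoped Classical in
/-- The circuits in `D` with edges of both colours. -/
noncomputable def mixedCircuits (σ : α → Sym2 V) (col : α → Bool) (D : Finset α) :
    Finset (Finset α) :=
  D.powerset.filter fun C => IsCirc σ C ∧ ∀ b, ∃ a ∈ C, col a = b

variable {σ : α → Sym2 V} {col : α → Bool} {D C H : Finset α} {t : ℝ}

lemma mem_mixedCircuits :
    C ∈ mixedCircuits σ col D ↔ C ⊆ D ∧ IsCirc σ C ∧ ∀ b, ∃ a ∈ C, col a = b := by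
  classical
  simp [mixedCircuits]

lemma exists_isCirc_subset (hH : IsEven σ H) (hne : H.Nonempty) : ∃ C ⊆ H, IsCirc σ C := by
  classical
  obtain ⟨C, hC, hmin⟩ := Finset.exists_min_image
    (H.powerset.filter fun K => IsEven σ K ∧ K.Nonempty) Finset.card
    ⟨H, by simp [hH, hne]⟩
  simp only [Finset.mem_filter, Finset.mem_powerset] at hC hmin
  exact ⟨C, hC.1, hC.2.2, hC.2.1, fun K hK hKE hKne =>
    Finset.eq_of_subset_of_card_le hK (hmin K ⟨hK.trans hC.1, hKE, hKne⟩)⟩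

/-- An even set is a disjoint union of two monochromatic even sets and bichromatic circuits. -/
lemma IsEven.exists_decomposition (hH : IsEven σ H) :
    ∃ (K : Bool → Finset α) (F : Finset (Finset α)),
      (∀ b, K b ⊆ colored col b H ∧ IsEven σ (K b)) ∧ F ⊆ mixedCircuits σ col H ∧
      K true ∪ K false ∪ F.biUnion id = H ∧
      (K true).card + (K false).card + ∑ C ∈ F, C.card = H.card := by
  induction H using Finset.strongInduction with
  | H H ih =>
    rcases H.eq_empty_or_nonempty with rfl | hne
    · exact ⟨fun _ => ∅, ∅, fun b => ⟨Finset.empty_subset _, isEven_empty⟩, by simp, by simp,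
        by simp⟩
    obtain ⟨C, hCH, hC⟩ := exists_isCirc_subset hH hne
    have hss : H \ C ⊂ H := Finset.sdiff_ssubset hCH hC.1
    obtain ⟨K, F, hK, hF, hU, hcard⟩ := ih (H \ C) hss (hH.sdiff hC.2.1 hCH)
    have hcardH : (H \ C).card + C.card = H.card := Finset.card_sdiff_add_card_eq_card hCH
    have hUH : H \ C ∪ C = H := Finset.sdiff_union_of_subset hCH
    have hKsub : ∀ b, K b ⊆ colored col b H := fun b =>
      (hK b).1.trans (Finset.filter_subset_filter _ Finset.sdiff_subset)
    have hFsub : F ⊆ mixedCircuits σ col H := fun L hL => by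
      have := mem_mixedCircuits.1 (hF hL)
      exact mem_mixedCircuits.2 ⟨this.1.trans Finset.sdiff_subset, this.2⟩
    -- A bichromatic circuit joins the family `F`; a monochromatic one is absorbed into the even set
    -- of its own colour.
    by_cases hmix : ∀ b, ∃ a ∈ C, col a = b
    · have hCF : C ∉ F := fun hCF => by
        obtain ⟨a, ha⟩ := hC.1
        have := (mem_mixedCircuits.1 (hF hCF)).1 ha
        exact (Finset.mem_sdiff.1 this).2 ha
      refine ⟨K, insert C F, fun b => ⟨hKsub b, (hK b).2⟩, ?_, ?_, ?_⟩
      · exact Finset.insert_subset (mem_mixedCircuits.2 ⟨hCH, hC, hmix⟩) hFsub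
      · rw [Finset.biUnion_insert, id, Finset.union_comm C, ← Finset.union_assoc, hU, hUH]
      · rw [Finset.sum_insert hCF]
        omega
    · push Not at hmix
      obtain ⟨b, hb⟩ := hmix
      have hdisj : Disjoint (K (!b)) C := by
        refine Finset.disjoint_left.2 fun a ha haC => ?_
        have := Finset.mem_of_mem_filter a ((hK _).1 ha)
        exact (Finset.mem_sdiff.1 this).2 haC
      have hCcol : C ⊆ colored col (!b) H := fun a ha =>
        Finset.mem_filter.2 ⟨hCH ha, by have := hb a ha; cases b <;> simp_all⟩
      refine ⟨Function.update K (!b) (K (!b) ∪ C), F, fun b' => ?_, hFsub, ?_, ?_⟩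
      · rcases eq_or_ne b' (!b) with rfl | h
        · rw [Function.update_self]
          exact ⟨Finset.union_subset (hKsub _) hCcol, (hK _).2.disjUnion hC.2.1 hdisj⟩
        · rw [Function.update_of_ne h]
          exact ⟨hKsub _, (hK _).2⟩
      · rw [← hUH, ← hU]
        cases b <;> simp [Finset.union_comm, Finset.union_left_comm]
      · have h1 := Finset.card_union_of_disjoint hdisj
        cases b
        · simp only [Bool.not_false] at h1 ⊢
          simp [h1]; omega
        · simp only [Bool.not_true] at h1 ⊢
          simp [h1]; omega

lemma evenSum_pos (ht : 0 ≤ t) : 0 < evenSum t σ D := by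
  classical
  refine lt_of_lt_of_le one_pos ?_
  have h : ({∅} : Finset (Finset α)) ⊆ D.powerset.filter (IsEven σ) := by
    simp [isEven_empty]
  have := Finset.sum_le_sum_of_subset_of_nonneg (f := fun H => t ^ H.card) h
    fun _ _ _ => pow_nonneg ht _
  simpa [evenSum] using this

/-- The decomposition is recorded as two even sets and an arbitrary family of bichromatic circuits.
Dropping disjointness within the family only adds nonnegative terms and makes the sum a product. -/
lemma evenSum_le (ht : 0 ≤ t) :
    evenSum t σ D ≤ evenSum t σ (colored col true D) * evenSum t σ (colored col false D) *
      ∏ C ∈ mixedCircuits σ col D, (1 + t ^ C.card) := by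
  classical
  have h : evenSum t σ (colored col true D) * evenSum t σ (colored col false D) *
      ∏ C ∈ mixedCircuits σ col D, (1 + t ^ C.card) =
      ∑ q ∈ ((colored col true D).powerset.filter (IsEven σ) ×ˢ
        (colored col false D).powerset.filter (IsEven σ)) ×ˢ (mixedCircuits σ col D).powerset,
        t ^ (q.1.1.card + q.1.2.card + ∑ C ∈ q.2, C.card) := by
    rw [Finset.prod_one_add, evenSum, evenSum, Finset.sum_mul_sum, ← Finset.sum_product',
      Finset.sum_mul_sum, ← Finset.sum_product']
    refine Finset.sum_congr rfl fun q _ => ?_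
    rw [Finset.prod_pow_eq_pow_sum, pow_add, pow_add]
  rw [h]
  refine sum_le_sum_of_cover (fun q => q.1.1 ∪ q.1.2 ∪ q.2.biUnion id) (fun H hH => ?_)
    fun q _ => pow_nonneg ht _
  simp only [Finset.mem_filter, Finset.mem_powerset] at hH
  obtain ⟨K, F, hK, hF, hU, hcard⟩ := hH.2.exists_decomposition (col := col)
  refine ⟨((K true, K false), F), ?_, hU, by rw [hcard]⟩
  simp only [Finset.mem_product, Finset.mem_filter, Finset.mem_powerset]
  have hc : ∀ b, colored col b H ⊆ colored col b D := fun b =>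
    Finset.filter_subset_filter _ hH.1
  refine ⟨⟨⟨(hK true).1.trans (hc _), (hK true).2⟩, (hK false).1.trans (hc _), (hK false).2⟩,
    fun L hL => ?_⟩
  have := mem_mixedCircuits.1 (hF hL)
  exact mem_mixedCircuits.2 ⟨this.1.trans hH.1, this.2⟩

variable [Fintype V] [LinearOrder V]

/-- The single flips generate {±1}^V. -/
lemma isEven_of_flow_flip (h : ∀ v, flow σ H (flip v) = 1) : IsEven σ H := by
  intro x
  let φ : (V → ℤˣ) →* ℤˣ :=
    { toFun := flow σ H
      map_one' := Finset.prod_eq_one fun a _ => by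
        induction σ a with
        | _ i j => simp
      map_mul' := flow_mul }
  have hx : x = ∏ v ∈ Finset.univ.filter fun v => x v = -1, flip v := by
    ext1 w
    rw [Finset.prod_apply]
    simp only [flip, Function.update_apply, Pi.one_apply]
    rw [Finset.prod_ite_eq]
    rcases Int.units_eq_one_or (x w) with h | h <;> simp [h]
  have h2 : φ x = 1 := by
    rw [hx, map_prod]
    exact Finset.prod_eq_one fun v _ => h v
  exact h2

/-- Start at the smallest vertex `i` of odd `true`-degree and take a largest `true`-coloured trail
`P` from it. Its end `j` also has odd `true`-degree, so `i < j`, and `Q` is the complement of `P`.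
Minimality of the circuit makes both acyclic. -/
lemma IsCirc.exists_split (hσ : ∀ a ∈ C, ¬ (σ a).IsDiag) (hC : IsCirc σ C)
    (hmix : ∀ b, ∃ a ∈ C, col a = b) :
    ∃ i j, i < j ∧ (∀ v, v = i ∨ v = j → ∀ b, ∃ a ∈ C, col a = b ∧ v ∈ σ a) ∧
      ∃ P Q, P ∪ Q = C ∧ P.card + Q.card = C.card ∧
        P ∈ endJoins σ C (colored col true C) i j ∧ Q ∈ endJoins σ C (colored col false C) i j := by
  classical
  set CT := colored col true C with hCT
  have hCTC : CT ⊆ C := Finset.filter_subset _ _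
  have hσT : ∀ a ∈ CT, ¬ (σ a).IsDiag := fun a ha => hσ a (hCTC ha)
  -- If the `true` part were even, minimality would make it the whole circuit, which has a `false`
  -- edge.
  have hTne : (Finset.univ.filter fun v => flow σ CT (flip v) ≠ 1).Nonempty := by
    by_contra hc
    rw [Finset.not_nonempty_iff_eq_empty, Finset.filter_eq_empty_iff] at hc
    have hE : IsEven σ CT := isEven_of_flow_flip fun v => by
      simpa using hc (Finset.mem_univ v)
    obtain ⟨a, ha, hcol⟩ := hmix true
    have h1 := hC.2.2 CT hCTC hE ⟨a, Finset.mem_filter.2 ⟨ha, hcol⟩⟩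
    obtain ⟨b, hb, hbcol⟩ := hmix false
    rw [← h1] at hb
    have := (Finset.mem_filter.1 hb).2
    simp [hbcol] at this
  set i := Finset.min' _ hTne with hi
  have hiT : flow σ CT (flip i) ≠ 1 := (Finset.mem_filter.1 (Finset.min'_mem _ hTne)).2
  have himin : ∀ v, flow σ CT (flip v) ≠ 1 → i ≤ v := fun v hv =>
    Finset.min'_le _ v (Finset.mem_filter.2 ⟨Finset.mem_univ v, hv⟩)
  obtain ⟨P, hP, hmax⟩ := Finset.exists_max_image
    (CT.powerset.filter fun P => ∃ j, IsJoin σ P i j) Finset.card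
    ⟨∅, by simpa using ⟨i, isJoin_self.2 isEven_empty⟩⟩
  simp only [Finset.mem_filter, Finset.mem_powerset] at hP hmax
  obtain ⟨hPT, j, hJ⟩ := hP
  -- An unused `true` edge at `j` would enlarge `P`.
  have hfree : ∀ a ∈ CT \ P, j ∉ σ a := by
    rintro a ha ⟨l, hl⟩
    obtain ⟨haT, haP⟩ := Finset.mem_sdiff.1 ha
    have h1 := hmax (insert a P) ⟨Finset.insert_subset haT hPT, l, hJ.insert haP hl⟩
    rw [Finset.card_insert_of_notMem haP] at h1
    omega
  have hflowj : flow σ CT (flip j) = flow σ P (flip j) := by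
    rw [← flow_sdiff hPT, flow_flip_of_forall (fun a ha => hσT a (Finset.sdiff_subset ha)) hfree,
      one_mul]
  have hij : i ≠ j := by
    intro h
    rw [← h] at hJ hflowj
    rw [hflowj, isJoin_self.1 hJ] at hiT
    exact hiT rfl
  have hjT : flow σ CT (flip j) ≠ 1 := by
    rw [hflowj, hJ.symm.flow_flip_left hij.symm]; decide
  have hlt : i < j := lt_of_le_of_ne (himin j hjT) hij
  have hends : ∀ v, v = i ∨ v = j → ∀ b, ∃ a ∈ C, col a = b ∧ v ∈ σ a := by
    intro v hv b
    have hvT : flow σ CT (flip v) ≠ 1 := by rcases hv with rfl | rfl <;> assumption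
    cases b
    -- The total degree in the circuit is even, so odd `true`-degree forces odd `false`-degree.
    · have h1 : flow σ (C \ CT) (flip v) ≠ 1 := fun h => by
        have := flow_sdiff (σ := σ) hCTC (flip v)
        rw [h, hC.2.1, one_mul] at this
        exact hvT this
      obtain ⟨a, ha, l, hl⟩ :=
        exists_mem_of_flow_flip (fun a ha => hσ a (Finset.sdiff_subset ha)) h1
      obtain ⟨haC, haT⟩ := Finset.mem_sdiff.1 ha
      refine ⟨a, haC, ?_, by rw [hl]; exact Sym2.mem_mk_left _ _⟩
      simpa [hCT, colored, haC] using haT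
    · obtain ⟨a, ha, l, hl⟩ := exists_mem_of_flow_flip hσT hvT
      exact ⟨a, hCTC ha, (Finset.mem_filter.1 ha).2, by rw [hl]; exact Sym2.mem_mk_left _ _⟩
  have hPC : P ⊆ C := hPT.trans hCTC
  have hPne : flow σ P (flip i) ≠ 1 := by rw [hJ.flow_flip_left hij]; decide
  have hPends : ∀ v, flow σ P (flip v) ≠ 1 → ∃ a ∈ P, a ∈ CT ∧ v ∈ σ a := fun v hv => by
    obtain ⟨a, ha, l, hl⟩ := exists_mem_of_flow_flip (fun a ha => hσT a (hPT ha)) hv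
    exact ⟨a, ha, hPT ha, by rw [hl]; exact Sym2.mem_mk_left _ _⟩
  have hQends : ∀ v, v = i ∨ v = j → ∃ a ∈ C \ P, a ∈ colored col false C ∧ v ∈ σ a :=
    fun v hv => by
      obtain ⟨a, ha, hcol, hva⟩ := hends v hv false
      refine ⟨a, Finset.mem_sdiff.2 ⟨ha, fun haP => ?_⟩, Finset.mem_filter.2 ⟨ha, hcol⟩, hva⟩
      have := (Finset.mem_filter.1 (hPT haP)).2
      simp [hcol] at this
  refine ⟨i, j, hlt, hends, P, C \ P, Finset.union_sdiff_of_subset hPC, ?_, ?_, ?_⟩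
  · have := Finset.card_sdiff_add_card_eq_card hPC
    omega
  · refine Finset.mem_filter.2 ⟨mem_joins.2 ⟨hPC, hJ, fun K hK hKE => ?_⟩, hPends i hPne,
      hPends j (by rwa [← hflowj])⟩
    by_contra hne
    have h1 := hC.2.2 K (hK.trans hPC) hKE (Finset.nonempty_iff_ne_empty.2 hne)
    obtain ⟨b, hb, hbcol⟩ := hmix false
    rw [← h1] at hb
    have := (Finset.mem_filter.1 (hPT (hK hb))).2
    simp [hbcol] at this
  · refine Finset.mem_filter.2 ⟨mem_joins.2 ⟨Finset.sdiff_subset,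
      hC.2.1.sdiff_isJoin hJ hPC, fun K hK hKE => ?_⟩, hQends i (Or.inl rfl), hQends j (Or.inr rfl)⟩
    by_contra hne
    have h1 := hC.2.2 K (hK.trans Finset.sdiff_subset) hKE (Finset.nonempty_iff_ne_empty.2 hne)
    obtain ⟨a, ha, -⟩ := hPends i hPne
    have haC := hPC ha
    rw [← h1] at haC
    exact (Finset.mem_sdiff.1 (hK haC)).2 ha

lemma endJoins_mono {D' E E' : Finset α} (h : D ⊆ D') (h' : E ⊆ E') (i j : V) :
    endJoins σ D E i j ⊆ endJoins σ D' E' i j := by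
  intro P hP
  obtain ⟨h1, ⟨a, ha, ha', hi⟩, b, hb, hb', hj⟩ := Finset.mem_filter.1 hP
  have h2 := mem_joins.1 h1
  exact Finset.mem_filter.2 ⟨mem_joins.2 ⟨h2.1.trans h, h2.2⟩, ⟨a, ha, h' ha', hi⟩, b, hb, h' hb', hj⟩

/-- A circuit is recovered as the union of its two trails. Ordering the split vertices saves a
factor 2, which the final constant needs. -/
lemma sum_mixedCircuits_le (ht : 0 ≤ t) (hσ : ∀ a ∈ D, ¬ (σ a).IsDiag) (S : Finset V)
    (hS : ∀ v, (∀ b, ∃ a ∈ D, col a = b ∧ v ∈ σ a) → v ∈ S) :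
    ∑ C ∈ mixedCircuits σ col D, t ^ C.card ≤
      ∑ p ∈ (S ×ˢ S).filter fun p => p.1 < p.2,
        endSum t σ D (colored col true D) p.1 p.2 * endSum t σ D (colored col false D) p.1 p.2 := by
  classical
  have h : ∑ p ∈ (S ×ˢ S).filter fun p => p.1 < p.2,
        endSum t σ D (colored col true D) p.1 p.2 * endSum t σ D (colored col false D) p.1 p.2 =
      ∑ q ∈ ((S ×ˢ S).filter fun p => p.1 < p.2).sigma fun p =>
        endJoins σ D (colored col true D) p.1 p.2 ×ˢ endJoins σ D (colored col false D) p.1 p.2,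
        t ^ (q.2.1.card + q.2.2.card) := by
    rw [Finset.sum_sigma]
    refine Finset.sum_congr rfl fun p _ => ?_
    rw [endSum, endSum, Finset.sum_mul_sum, ← Finset.sum_product']
    simp only [pow_add]
  rw [h]
  refine sum_le_sum_of_cover (fun q => q.2.1 ∪ q.2.2) (fun C hC => ?_) fun q _ => pow_nonneg ht _
  obtain ⟨hCD, hCirc, hmix⟩ := mem_mixedCircuits.1 hC
  obtain ⟨i, j, hij, hends, P, Q, hU, hcard, hP, hQ⟩ :=
    hCirc.exists_split (fun a ha => hσ a (hCD ha)) hmix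
  have hmem : ∀ v, v = i ∨ v = j → v ∈ S := fun v hv => hS v fun b => by
    obtain ⟨a, ha, h⟩ := hends v hv b
    exact ⟨a, hCD ha, h⟩
  have hc : ∀ b, colored col b C ⊆ colored col b D := fun b => Finset.filter_subset_filter _ hCD
  refine ⟨⟨(i, j), P, Q⟩, ?_, hU, by rw [hcard]⟩
  simp only [Finset.mem_sigma, Finset.mem_filter, Finset.mem_product]
  exact ⟨⟨⟨hmem i (Or.inl rfl), hmem j (Or.inr rfl)⟩, hij⟩, endJoins_mono hCD (hc _) _ _ hP,
    endJoins_mono hCD (hc _) _ _ hQ⟩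

end Multigraph

/-! ### High-temperature expansion -/

section Multigraph

variable {V α : Type*} [DecidableEq α] [Fintype V] [DecidableEq V]

/-- The edge sign as a real number. -/
def edgeSpin (x : V → ℤˣ) (e : Sym2 V) : ℝ := ((edgeSign x e : ℤ) : ℝ)

variable {σ : α → Sym2 V} {D H : Finset α} {t : ℝ}

lemma prod_edgeSpin (x : V → ℤˣ) : ∏ a ∈ H, edgeSpin x (σ a) = ((flow σ H x : ℤ) : ℝ) := by
  simp [edgeSpin, flow]

-- Orthogonality of characters: translating by a configuration where the flow is −1 negates the sum.
open scoped Classical in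
lemma sum_flow : ∑ x : V → ℤˣ, ((flow σ H x : ℤ) : ℝ) =
    if IsEven σ H then 2 ^ Fintype.card V else 0 := by
  split_ifs with h
  · simp [h _]
  · obtain ⟨y, hy⟩ := not_forall.1 h
    have hy' : flow σ H y = -1 := (Int.units_eq_one_or _).resolve_left hy
    have h1 : ∑ x : V → ℤˣ, ((flow σ H x : ℤ) : ℝ) = ∑ x : V → ℤˣ, ((flow σ H (y * x) : ℤ) : ℝ) :=
      (Equiv.sum_comp (Equiv.mulLeft y) fun x => ((flow σ H x : ℤ) : ℝ)).symm
    simp only [flow_mul, hy', Units.val_neg, neg_mul, one_mul, Int.cast_neg,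
      Finset.sum_neg_distrib] at h1
    linarith

lemma sum_prod_one_add_edgeSpin :
    ∑ x : V → ℤˣ, ∏ a ∈ D, (1 + t * edgeSpin x (σ a)) =
      2 ^ Fintype.card V * evenSum t σ D := by
  classical
  simp only [Finset.prod_one_add, Finset.prod_mul_distrib, Finset.prod_const, prod_edgeSpin]
  rw [Finset.sum_comm]
  simp only [← Finset.mul_sum, sum_flow, evenSum, Finset.sum_filter]
  rw [Finset.mul_sum]
  refine Finset.sum_congr rfl fun H _ => ?_
  split_ifs <;> ring

lemma exp_mul_edgeSpin (u : ℝ) (x : V → ℤˣ) (e : Sym2 V) :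
    Real.exp (u * edgeSpin x e) = Real.cosh u * (1 + Real.tanh u * edgeSpin x e) := by
  have hc : Real.cosh u ≠ 0 := (Real.cosh_pos u).ne'
  rw [Real.tanh_eq_sinh_div_cosh]
  rcases Int.units_eq_one_or (edgeSign x e) with h | h
  · simp only [edgeSpin, h, Units.val_one, Int.cast_one, mul_one]
    rw [mul_add, mul_div_cancel₀ _ hc, mul_one, Real.cosh_add_sinh]
  · simp only [edgeSpin, h, Units.val_neg, Units.val_one, Int.cast_neg, Int.cast_one, mul_neg,
      mul_one]
    rw [mul_add, mul_neg, mul_div_cancel₀ _ hc, mul_one, ← sub_eq_add_neg, Real.cosh_sub_sinh]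

end Multigraph

/-! ### Correlation of the likelihoods of two Ising models -/

section Ising

variable {d : ℕ}

open scoped Classical in
lemma sum_adj_eq (G : SimpleGraph (Fin d)) (f : Sym2 (Fin d) → ℝ) :
    ∑ i, ∑ j, (if G.Adj i j then f s(i, j) else 0) =
      2 * ∑ e ∈ Finset.univ.filter (· ∈ G.edgeSet), f e := by
  rw [← Finset.sum_product', Finset.univ_product_univ, ← Finset.sum_filter,
    ← Finset.sum_fiberwise_of_maps_to (g := fun p : Fin d × Fin d => s(p.1, p.2))
      (t := Finset.univ.filter (· ∈ G.edgeSet)) (by simp), Finset.mul_sum]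
  refine Finset.sum_congr rfl fun e he => ?_
  induction e with
  | _ a b =>
    have hab : G.Adj a b := by simpa using he
    have : ((Finset.univ.filter fun p : Fin d × Fin d => G.Adj p.1 p.2).filter
        fun p => s(p.1, p.2) = s(a, b)) = {(a, b), (b, a)} := by
      ext ⟨p, q⟩
      simp only [Finset.mem_filter, Finset.mem_univ, true_and, Sym2.eq_iff, Finset.mem_insert,
        Finset.mem_singleton, Prod.mk.injEq]
      constructor
      · exact fun h => h.2
      · rintro (⟨rfl, rfl⟩ | ⟨rfl, rfl⟩)
        · exact ⟨hab, Or.inl ⟨rfl, rfl⟩⟩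
        · exact ⟨hab.symm, Or.inr ⟨rfl, rfl⟩⟩
    rw [this, Finset.sum_pair (by simp [hab.ne]), Sym2.eq_swap (a := b)]
    ring

lemma adj_apply (G : SimpleGraph (Fin d)) (i j : Fin d) [Decidable (G.Adj i j)] :
    adj G i j = if G.Adj i j then 1 else 0 := by
  simp only [adj, SimpleGraph.adjMatrix_apply]
  congr

open scoped Classical in
/-- The edges of a pair of graphs, coloured by the graph they belong to. -/
noncomputable def pairEdges (K : Bool → SimpleGraph (Fin d)) : Finset (Bool × Sym2 (Fin d)) :=
  Finset.univ.filter fun a => a.2 ∈ (K a.1).edgeSet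

variable {K : Bool → SimpleGraph (Fin d)} {θ : ℝ}

lemma mem_pairEdges {a : Bool × Sym2 (Fin d)} : a ∈ pairEdges K ↔ a.2 ∈ (K a.1).edgeSet := by
  simp [pairEdges]

lemma not_isDiag_of_mem_pairEdges {a : Bool × Sym2 (Fin d)} (ha : a ∈ pairEdges K) :
    ¬ a.2.IsDiag :=
  (K a.1).not_isDiag_of_mem_edgeSet (mem_pairEdges.1 ha)

open scoped Classical in
lemma prod_colored_pairEdges {M : Type*} [CommMonoid M] (b : Bool) (f : Sym2 (Fin d) → M) :
    ∏ a ∈ colored Prod.fst b (pairEdges K), f a.2 =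
      ∏ e ∈ Finset.univ.filter (· ∈ (K b).edgeSet), f e := by
  refine Finset.prod_bij' (fun a _ => a.2) (fun e _ => (b, e)) ?_ ?_ ?_ ?_ ?_
  · rintro ⟨c, e⟩ ha
    simp only [colored, Finset.mem_filter, mem_pairEdges] at ha
    obtain ⟨h, rfl⟩ := ha
    simpa using h
  · intro e he
    simpa [colored, mem_pairEdges] using he
  · rintro ⟨c, e⟩ ha
    simp only [colored, Finset.mem_filter] at ha
    simp [ha.2]
  · simp
  · simp

/-- The exponent runs over ordered pairs, so each edge carries 2θ; this is why the expansion
parameter is tanh 2θ. -/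
lemma weight_smul_adj (b : Bool) (x : Config d) :
    weight (θ • adj (K b)) x = Real.cosh (2 * θ) ^ (colored Prod.fst b (pairEdges K)).card *
      ∏ a ∈ colored Prod.fst b (pairEdges K), (1 + Real.tanh (2 * θ) * edgeSpin x a.2) := by
  classical
  rw [← Finset.prod_const, ← Finset.prod_mul_distrib]
  simp only [← exp_mul_edgeSpin]
  rw [prod_colored_pairEdges b (fun e => Real.exp (2 * θ * edgeSpin x e)), ← Real.exp_sum,
    ← Finset.mul_sum, mul_comm 2 θ, mul_assoc, ← sum_adj_eq, weight, Finset.mul_sum]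
  congr 1
  refine Finset.sum_congr rfl fun i _ => ?_
  rw [Finset.mul_sum]
  refine Finset.sum_congr rfl fun j _ => ?_
  rw [Matrix.smul_apply, adj_apply, smul_eq_mul, mul_assoc, mul_assoc]
  split_ifs <;> simp [edgeSpin, spin]

lemma weight_pos (Θ : Matrix (Fin d) (Fin d) ℝ) (x : Config d) : 0 < weight Θ x := Real.exp_pos _

lemma partition_pos (Θ : Matrix (Fin d) (Fin d) ℝ) : 0 < partition Θ :=
  Finset.sum_pos (fun x _ => weight_pos Θ x) Finset.univ_nonempty

lemma partition_smul_adj (b : Bool) :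
    partition (θ • adj (K b)) = Real.cosh (2 * θ) ^ (colored Prod.fst b (pairEdges K)).card *
      (2 ^ d * evenSum (Real.tanh (2 * θ)) Prod.snd (colored Prod.fst b (pairEdges K))) := by
  simp only [partition, weight_smul_adj, ← Finset.mul_sum]
  rw [sum_prod_one_add_edgeSpin, Fintype.card_fin]

lemma tanh_two_mul_nonneg (hθ : 0 ≤ θ) : 0 ≤ Real.tanh (2 * θ) := by
  rw [Real.tanh_eq_sinh_div_cosh]
  exact div_nonneg (Real.sinh_nonneg_iff.2 (by linarith)) (Real.cosh_pos _).le

/-- The normalised correlation of the likelihoods of two Ising models is bounded through the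
bichromatic circuits of the two graphs. -/
lemma sum_pmf_mul_pmf_le (hθ : 0 ≤ θ) :
    2 ^ d * ∑ x, pmf (θ • adj (K true)) x * pmf (θ • adj (K false)) x ≤
      Real.exp (∑ C ∈ mixedCircuits Prod.snd Prod.fst (pairEdges K),
        Real.tanh (2 * θ) ^ C.card) := by
  classical
  set t := Real.tanh (2 * θ)
  have ht : 0 ≤ t := tanh_two_mul_nonneg hθ
  set c := Real.cosh (2 * θ)
  have hc : 0 < c := Real.cosh_pos _
  set D := pairEdges K
  set z := fun b => evenSum t Prod.snd (colored Prod.fst b D)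
  have hz : ∀ b, 0 < z b := fun b => evenSum_pos ht
  have hD : ∀ x : Config d,
      (∏ a ∈ colored Prod.fst true D, (1 + t * edgeSpin x a.2)) *
        ∏ a ∈ colored Prod.fst false D, (1 + t * edgeSpin x a.2) =
      ∏ a ∈ D, (1 + t * edgeSpin x (Prod.snd a)) := fun x => by
    rw [← Finset.prod_filter_mul_prod_filter_not D (fun a => a.1 = true)]
    simp [colored]
  have hsum : ∑ x, weight (θ • adj (K true)) x * weight (θ • adj (K false)) x =
      c ^ (colored Prod.fst true D).card * c ^ (colored Prod.fst false D).card *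
        (2 ^ d * evenSum t Prod.snd D) := by
    have hzD := sum_prod_one_add_edgeSpin (V := Fin d) (σ := Prod.snd) (D := D) (t := t)
    rw [Fintype.card_fin] at hzD
    rw [← hzD, Finset.mul_sum]
    refine Finset.sum_congr rfl fun x _ => ?_
    rw [weight_smul_adj, weight_smul_adj, ← hD, mul_mul_mul_comm]
  -- The powers of cosh and of 2 cancel between numerator and partition functions.
  have heq : 2 ^ d * ∑ x, pmf (θ • adj (K true)) x * pmf (θ • adj (K false)) x =
      evenSum t Prod.snd D / (z true * z false) := by
    have h1 : ∑ x, pmf (θ • adj (K true)) x * pmf (θ • adj (K false)) x =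
        (∑ x, weight (θ • adj (K true)) x * weight (θ • adj (K false)) x) /
          (partition (θ • adj (K true)) * partition (θ • adj (K false))) := by
      rw [Finset.sum_div]
      exact Finset.sum_congr rfl fun x _ => div_mul_div_comm _ _ _ _
    have hp : ∀ b, partition (θ • adj (K b)) = c ^ (colored Prod.fst b D).card * (2 ^ d * z b) :=
      fun b => partition_smul_adj b
    rw [h1, hsum, hp, hp]
    have h2 := (hz true).ne'
    have h3 := (hz false).ne'
    field_simp
  rw [heq, div_le_iff₀ (mul_pos (hz true) (hz false)), Real.exp_sum]
  refine (evenSum_le (col := Prod.fst) ht).trans ?_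
  rw [mul_comm]
  refine mul_le_mul_of_nonneg_right ?_ (mul_pos (hz true) (hz false)).le
  refine Finset.prod_le_prod (fun C _ => by positivity) fun C _ => ?_
  rw [add_comm]
  exact Real.add_one_le_exp _

end Ising

/-! ### Norm bounds -/

section Norms

variable {d : ℕ} {A B M w : Matrix (Fin d) (Fin d) ℝ} {t Λ Γ : ℝ}

lemma frob_nonneg (A : Matrix (Fin d) (Fin d) ℝ) : 0 ≤ frob A := Real.sqrt_nonneg _

lemma frob_sq (A : Matrix (Fin d) (Fin d) ℝ) : frob A ^ 2 = ∑ i, ∑ j, A i j ^ 2 :=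
  Real.sq_sqrt (Finset.sum_nonneg fun _ _ => Finset.sum_nonneg fun _ _ => sq_nonneg _)

section

attribute [local instance] Matrix.frobeniusNormedAddCommGroup Matrix.frobeniusNormedSpace

lemma frob_eq_norm (A : Matrix (Fin d) (Fin d) ℝ) : frob A = ‖A‖ := by
  rw [Matrix.frobenius_norm_def, frob, Real.sqrt_eq_rpow]
  simp

lemma frob_add_le (A B : Matrix (Fin d) (Fin d) ℝ) : frob (A + B) ≤ frob A + frob B := by
  simpa only [frob_eq_norm] using norm_add_le A B

lemma frob_mul_le (A B : Matrix (Fin d) (Fin d) ℝ) : frob (A * B) ≤ frob A * frob B := by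
  simpa only [frob_eq_norm] using Matrix.frobenius_norm_mul A B

lemma frob_smul (c : ℝ) (A : Matrix (Fin d) (Fin d) ℝ) : frob (c • A) = |c| * frob A := by
  simpa only [frob_eq_norm, Real.norm_eq_abs] using norm_smul c A

end

lemma frob_mono (hA : ∀ i j, 0 ≤ A i j) (h : ∀ i j, A i j ≤ B i j) : frob A ≤ frob B :=
  Real.sqrt_le_sqrt (Finset.sum_le_sum fun i _ => Finset.sum_le_sum fun j _ =>
    pow_le_pow_left₀ (hA i j) (h i j) 2)

lemma mul_apply_nonneg (hA : ∀ i j, 0 ≤ A i j) (hB : ∀ i j, 0 ≤ B i j) (i j : Fin d) :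
    0 ≤ (A * B) i j := by
  rw [Matrix.mul_apply]
  exact Finset.sum_nonneg fun k _ => mul_nonneg (hA i k) (hB k j)

lemma mul_apply_le_of_le_one_add (hA : ∀ i j, 0 ≤ A i j)
    (h : ∀ i j, w i j ≤ (1 + t • (w * M)) i j) (i j : Fin d) :
    (A * w) i j ≤ (A + t • (A * w * M)) i j := by
  have h1 : A + t • (A * w * M) = A * (1 + t • (w * M)) := by
    rw [mul_add, mul_one, Matrix.mul_smul, mul_assoc]
  rw [h1, Matrix.mul_apply, Matrix.mul_apply]
  exact Finset.sum_le_sum fun k _ => mul_le_mul_of_nonneg_left (h k j) (hA i k)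

/-- Absorption at the largest entry μ of `A * w`: the recursion gives μ ≤ 1 + μ/2. -/
lemma mul_apply_le_two (ht : 0 ≤ t) (hA : ∀ i j, 0 ≤ A i j) (hA1 : ∀ i j, A i j ≤ 1)
    (hw : ∀ i j, 0 ≤ w i j) (hM : ∀ i j, 0 ≤ M i j) (hMΓ : ∀ j, ∑ l, M l j ≤ 2 * Γ)
    (htΓ : t * (2 * Γ) ≤ 1 / 2) (h : ∀ i j, w i j ≤ (1 + t • (w * M)) i j) (i j : Fin d) :
    (A * w) i j ≤ 2 := by
  have : Nonempty (Fin d × Fin d) := ⟨(i, j)⟩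
  obtain ⟨⟨p, q⟩, hmax⟩ := Finite.exists_max fun u : Fin d × Fin d => (A * w) u.1 u.2
  set μ := (A * w) p q with hμ
  have hμ0 : 0 ≤ μ := mul_apply_nonneg hA hw p q
  have h1 : (A * w * M) p q ≤ μ * (2 * Γ) := by
    rw [Matrix.mul_apply]
    calc ∑ l, (A * w) p l * M l q ≤ ∑ l, μ * M l q :=
          Finset.sum_le_sum fun l _ => mul_le_mul_of_nonneg_right (hmax (p, l)) (hM l q)
      _ = μ * ∑ l, M l q := (Finset.mul_sum _ _ _).symm
      _ ≤ μ * (2 * Γ) := mul_le_mul_of_nonneg_left (hMΓ q) hμ0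
  have h2 := mul_apply_le_of_le_one_add hA h p q
  rw [Matrix.add_apply, Matrix.smul_apply, smul_eq_mul, ← hμ] at h2
  have h3 : t * (A * w * M) p q ≤ t * (μ * (2 * Γ)) := mul_le_mul_of_nonneg_left h1 ht
  have h4 : t * (μ * (2 * Γ)) ≤ μ * (1 / 2) := by
    calc t * (μ * (2 * Γ)) = μ * (t * (2 * Γ)) := by ring
      _ ≤ _ := mul_le_mul_of_nonneg_left htΓ hμ0
  have h5 := hA1 p q
  have h6 : (A * w) i j ≤ μ := hmax (i, j)
  linarith

lemma mul_mul_apply_le (ht : 0 ≤ t) (hA : ∀ i j, 0 ≤ A i j) (hA1 : ∀ i j, A i j ≤ 1)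
    (hAΓ : ∀ j, ∑ l, A l j ≤ Γ)
    (hw : ∀ i j, 0 ≤ w i j) (hM : ∀ i j, 0 ≤ M i j) (hMΓ : ∀ j, ∑ l, M l j ≤ 2 * Γ)
    (htΓ : t * (2 * Γ) ≤ 1 / 2) (h : ∀ i j, w i j ≤ (1 + t • (w * M)) i j) (i j : Fin d) :
    (A * w * A) i j ≤ 2 * Γ := by
  rw [Matrix.mul_apply]
  calc ∑ l, (A * w) i l * A l j ≤ ∑ l, 2 * A l j :=
        Finset.sum_le_sum fun l _ => mul_le_mul_of_nonneg_right
          (mul_apply_le_two ht hA hA1 hw hM hMΓ htΓ h i l) (hA l j)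
    _ = 2 * ∑ l, A l j := (Finset.mul_sum _ _ _).symm
    _ ≤ 2 * Γ := by linarith [hAΓ j]

/-- The same absorption in Frobenius norm: y = `frob (A * w)` satisfies y ≤ Λ + y/2. -/
lemma frob_mul_mul_le (ht : 0 ≤ t) (hA : ∀ i j, 0 ≤ A i j) (hAΛ : frob A ≤ Λ)
    (hw : ∀ i j, 0 ≤ w i j) (hMΛ : frob M ≤ 2 * Λ) (htΛ : t * (2 * Λ) ≤ 1 / 2)
    (h : ∀ i j, w i j ≤ (1 + t • (w * M)) i j) :
    frob (A * w * A) ≤ 2 * Λ ^ 2 := by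
  have hy : frob (A * w) ≤ 2 * Λ := by
    have h1 : frob (A * w) ≤ frob (A + t • (A * w * M)) :=
      frob_mono (mul_apply_nonneg hA hw) (mul_apply_le_of_le_one_add hA h)
    have h2 := frob_add_le A (t • (A * w * M))
    rw [frob_smul, abs_of_nonneg ht] at h2
    have h3 : t * frob (A * w * M) ≤ t * (frob (A * w) * (2 * Λ)) :=
      mul_le_mul_of_nonneg_left ((frob_mul_le _ _).trans
        (mul_le_mul_of_nonneg_left hMΛ (frob_nonneg _))) ht
    have h4 : t * (frob (A * w) * (2 * Λ)) ≤ frob (A * w) * (1 / 2) := by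
      calc t * (frob (A * w) * (2 * Λ)) = frob (A * w) * (t * (2 * Λ)) := by ring
        _ ≤ _ := mul_le_mul_of_nonneg_left htΛ (frob_nonneg _)
    linarith
  have hΛ : 0 ≤ Λ := (frob_nonneg A).trans hAΛ
  calc frob (A * w * A) ≤ frob (A * w) * frob A := frob_mul_le _ _
    _ ≤ 2 * Λ * Λ := mul_le_mul hy hAΛ (frob_nonneg _) (by linarith)
    _ = 2 * Λ ^ 2 := by ring

end Norms

/-- The function x cosh x − sinh x vanishes at 0 and has derivative x sinh x ≥ 0 for x ≥ 0. -/
lemma tanh_le_self {u : ℝ} (hu : 0 ≤ u) : Real.tanh u ≤ u := by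
  have hd : ∀ x : ℝ, HasDerivAt (fun x => x * Real.cosh x - Real.sinh x)
      (1 * Real.cosh x + x * Real.sinh x - Real.cosh x) x := fun x =>
    ((hasDerivAt_id x).mul (Real.hasDerivAt_cosh x)).sub (Real.hasDerivAt_sinh x)
  have hmono : MonotoneOn (fun x => x * Real.cosh x - Real.sinh x) (Set.Ici 0) := by
    refine monotoneOn_of_deriv_nonneg (convex_Ici 0)
      (fun x _ => (hd x).continuousAt.continuousWithinAt)
      (fun x _ => (hd x).differentiableAt.differentiableWithinAt) fun x hx => ?_
    rw [interior_Ici] at hx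
    rw [(hd x).deriv]
    have := mul_nonneg (le_of_lt hx) (Real.sinh_nonneg_iff.2 (le_of_lt hx))
    linarith
  have h := hmono Set.self_mem_Ici hu hu
  simp only [Real.sinh_zero, zero_mul, sub_zero, sub_nonneg] at h
  rw [Real.tanh_eq_sinh_div_cosh, div_le_iff₀ (Real.cosh_pos u)]
  exact h

/-! ### Trail sums and circuit sums for a pair of graphs -/

section Pair

variable {d : ℕ} {K : Bool → SimpleGraph (Fin d)} {θ Λ Γ R : ℝ}

lemma adj_nonneg (G : SimpleGraph (Fin d)) (i j : Fin d) : 0 ≤ adj G i j := by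
  classical
  rw [adj_apply]; split_ifs <;> norm_num

lemma adj_le_one (G : SimpleGraph (Fin d)) (i j : Fin d) : adj G i j ≤ 1 := by
  classical
  rw [adj_apply]; split_ifs <;> norm_num

lemma adj_sq (G : SimpleGraph (Fin d)) (i j : Fin d) : adj G i j ^ 2 = adj G i j := by
  classical
  rw [adj_apply]; split_ifs <;> norm_num

lemma adj_comm (G : SimpleGraph (Fin d)) (i j : Fin d) : adj G i j = adj G j i := by
  classical
  simp only [adj_apply, G.adj_comm]

lemma mult_colored (b : Bool) (i j : Fin d) :
    mult Prod.snd (colored Prod.fst b (pairEdges K)) i j = adj (K b) i j := by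
  classical
  rw [adj_apply, mult]
  split_ifs with h
  · have : (colored Prod.fst b (pairEdges K)).filter (fun a => a.2 = s(i, j)) = {(b, s(i, j))} := by
      ext ⟨c, e⟩
      simp only [colored, Finset.mem_filter, mem_pairEdges, Finset.mem_singleton, Prod.mk.injEq]
      constructor
      · exact fun h => ⟨h.1.2, h.2⟩
      · rintro ⟨rfl, rfl⟩
        exact ⟨⟨h, rfl⟩, rfl⟩
    rw [this]; simp
  · rw [Finset.filter_eq_empty_iff.2]
    · simp
    · rintro ⟨c, e⟩ ha rfl
      simp only [colored, Finset.mem_filter, mem_pairEdges] at ha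
      obtain ⟨ha, rfl⟩ := ha
      exact h ha

lemma mult_pairEdges (i j : Fin d) :
    mult Prod.snd (pairEdges K) i j = (adj (K true) + adj (K false)) i j := by
  rw [Matrix.add_apply, ← mult_colored, ← mult_colored, mult, mult, mult, ← Nat.cast_add,
    ← Finset.card_filter_add_card_filter_not (s := (pairEdges K).filter fun a => a.2 = s(i, j))
      (fun a => a.1 = true)]
  simp only [colored, Finset.filter_filter, Bool.not_eq_true, and_comm]

/-- The generating function of the acyclic trails in a pair of graphs, as a matrix. -/
noncomputable def pathMatrix (t : ℝ) (K : Bool → SimpleGraph (Fin d)) : Matrix (Fin d) (Fin d) ℝ :=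
  Matrix.of fun i j => pathSum t Prod.snd (pairEdges K) i j

/-- The generating function of the trails between vertices that are at least two steps long and have
edges of colour `b` at both ends, as a matrix. -/
noncomputable def endMatrix (t : ℝ) (K : Bool → SimpleGraph (Fin d)) (b : Bool) :
    Matrix (Fin d) (Fin d) ℝ :=
  adj (K b) * pathMatrix t K * adj (K b)

variable {t : ℝ}

lemma pathMatrix_apply (i j : Fin d) :
    pathMatrix t K i j = pathSum t Prod.snd (pairEdges K) i j := rfl

lemma pathMatrix_nonneg (ht : 0 ≤ t) (i j : Fin d) : 0 ≤ pathMatrix t K i j := by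
  rw [pathMatrix_apply]; exact pathSum_nonneg ht

lemma pathMatrix_le (ht : 0 ≤ t) (i j : Fin d) :
    pathMatrix t K i j ≤ (1 + t • (pathMatrix t K * (adj (K true) + adj (K false)))) i j := by
  have h := pathSum_le ht (fun a ha => not_isDiag_of_mem_pairEdges (K := K) ha) i j
  rw [Matrix.add_apply, Matrix.smul_apply, Matrix.mul_apply, Matrix.one_apply, smul_eq_mul]
  simpa only [mult_pairEdges, pathMatrix_apply] using h

lemma endMatrix_nonneg (ht : 0 ≤ t) (b : Bool) (i j : Fin d) : 0 ≤ endMatrix t K b i j :=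
  mul_apply_nonneg (mul_apply_nonneg (adj_nonneg _) (pathMatrix_nonneg ht)) (adj_nonneg _) i j

lemma endMatrix_comm (b : Bool) (i j : Fin d) : endMatrix t K b i j = endMatrix t K b j i := by
  have h1 : (adj (K b)).transpose = adj (K b) := Matrix.ext fun i j => adj_comm _ _ _
  have h2 : (pathMatrix t K).transpose = pathMatrix t K := Matrix.ext fun i j => by
    rw [Matrix.transpose_apply, pathMatrix_apply, pathMatrix_apply, pathSum_comm]
  have h : (endMatrix t K b).transpose = endMatrix t K b := by
    rw [endMatrix, Matrix.transpose_mul, Matrix.transpose_mul, h1, h2, mul_assoc]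
  exact congrFun (congrFun h j) i

lemma endSum_pairEdges_le (ht : 0 ≤ t) (b : Bool) {i j : Fin d} (hij : i ≠ j) :
    endSum t Prod.snd (pairEdges K) (colored Prod.fst b (pairEdges K)) i j ≤
      t * adj (K b) i j + t ^ 2 * endMatrix t K b i j := by
  refine (endSum_le ht hij).trans (le_of_eq ?_)
  simp only [mult_colored]
  rw [endMatrix, Matrix.mul_apply, Finset.sum_comm]
  simp only [Matrix.mul_apply, Finset.sum_mul, pathMatrix_apply]

/-- A symmetric sum over ordered pairs is bounded by half of the sum over all pairs. -/
lemma two_mul_sum_lt_le (S : Finset (Fin d)) (g : Fin d → Fin d → ℝ) (hg : ∀ i j, 0 ≤ g i j)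
    (hsymm : ∀ i j, g i j = g j i) :
    2 * ∑ p ∈ (S ×ˢ S).filter (fun p => p.1 < p.2), g p.1 p.2 ≤ ∑ i ∈ S, ∑ j ∈ S, g i j := by
  have h1 : ∑ p ∈ (S ×ˢ S).filter (fun p => p.1 < p.2), g p.1 p.2 =
      ∑ p ∈ (S ×ˢ S).filter (fun p => p.2 < p.1), g p.1 p.2 := by
    refine Finset.sum_bij' (fun p _ => p.swap) (fun p _ => p.swap) ?_ ?_ ?_ ?_ ?_
    · simp +contextual
    · simp +contextual
    · simp
    · simp
    · exact fun p _ => hsymm _ _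
  have h2 : Disjoint ((S ×ˢ S).filter fun p => p.1 < p.2) ((S ×ˢ S).filter fun p => p.2 < p.1) :=
    Finset.disjoint_filter.2 fun p _ h h' => lt_asymm h h'
  rw [two_mul]
  nth_rw 2 [h1]
  rw [← Finset.sum_union h2, ← Finset.sum_product']
  refine Finset.sum_le_sum_of_subset_of_nonneg ?_ fun p _ _ => hg _ _
  exact Finset.union_subset (Finset.filter_subset _ _) (Finset.filter_subset _ _)

/-- Bound on the squared generating functions of the trails between vertices of `S`. -/
lemma sum_endBound_sq_le (ht : 0 ≤ t) (htθ : t ≤ 2 * θ) (b : Bool)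
    (hΛ : ∀ b, frob (adj (K b)) ≤ Λ) (hΓ : ∀ b j, ∑ l, adj (K b) l j ≤ Γ)
    (h8Λ : 8 * θ * Λ ≤ 1) (h8Γ : 8 * θ * Γ ≤ 1) (hR0 : 0 ≤ R) (S : Finset (Fin d))
    (hR : ∑ i ∈ S, ∑ j ∈ S, adj (K b) i j ≤ 2 * R * S.card)
    (hB : θ ^ 2 * (512 * Λ ^ 4) ≤ R ∨ θ ^ 2 * (160 * Γ ^ 2 * S.card) ≤ R) :
    ∑ i ∈ S, ∑ j ∈ S, (t * adj (K b) i j + t ^ 2 * endMatrix t K b i j) ^ 2 ≤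
      t ^ 2 * (2.995 * R * S.card) := by
  rcases S.eq_empty_or_nonempty with rfl | hS
  · simp
  have hs : (1 : ℝ) ≤ S.card := by exact_mod_cast hS.card_pos
  have hΛ0 : 0 ≤ Λ := (frob_nonneg _).trans (hΛ true)
  have hΓ0 : 0 ≤ Γ := (Finset.sum_nonneg fun l _ => adj_nonneg (K true) l hS.choose).trans (hΓ _ _)
  have hθ : 0 ≤ θ := by linarith
  have htΛ : t * (2 * Λ) ≤ 1 / 2 := by nlinarith [mul_le_mul_of_nonneg_right htθ hΛ0]
  have htΓ : t * (2 * Γ) ≤ 1 / 2 := by nlinarith [mul_le_mul_of_nonneg_right htθ hΓ0]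
  have hM0 : ∀ i j, 0 ≤ (adj (K true) + adj (K false)) i j := fun i j =>
    add_nonneg (adj_nonneg _ _ _) (adj_nonneg _ _ _)
  have hMΓ : ∀ j, ∑ l, (adj (K true) + adj (K false)) l j ≤ 2 * Γ := fun j => by
    simp only [Matrix.add_apply, Finset.sum_add_distrib]
    linarith [hΓ true j, hΓ false j]
  have hMΛ : frob (adj (K true) + adj (K false)) ≤ 2 * Λ := by
    linarith [frob_add_le (adj (K true)) (adj (K false)), hΛ true, hΛ false]
  set z := endMatrix t K b with hz
  have hz0 : ∀ i j, 0 ≤ z i j := endMatrix_nonneg ht b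
  have hzΛ : frob z ≤ 2 * Λ ^ 2 :=
    frob_mul_mul_le ht (adj_nonneg _) (hΛ b) (pathMatrix_nonneg ht) hMΛ htΛ (pathMatrix_le ht)
  have hzΓ : ∀ i j, z i j ≤ 2 * Γ := mul_mul_apply_le ht (adj_nonneg _) (adj_le_one _) (hΓ b)
    (pathMatrix_nonneg ht) hM0 hMΓ htΓ (pathMatrix_le ht)
  set Y := ∑ i ∈ S, ∑ j ∈ S, z i j ^ 2 with hY
  have hY0 : 0 ≤ Y := Finset.sum_nonneg fun i _ => Finset.sum_nonneg fun j _ => sq_nonneg _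
  have hYΛ : Y ≤ 4 * Λ ^ 4 := by
    calc Y ≤ ∑ i, ∑ j, z i j ^ 2 := by
          refine (Finset.sum_le_sum fun i _ => Finset.sum_le_sum_of_subset_of_nonneg
            (Finset.subset_univ S) fun j _ _ => sq_nonneg (z i j)).trans ?_
          exact Finset.sum_le_sum_of_subset_of_nonneg (Finset.subset_univ S) fun i _ _ =>
            Finset.sum_nonneg fun j _ => sq_nonneg _
      _ = frob z ^ 2 := (frob_sq z).symm
      _ ≤ (2 * Λ ^ 2) ^ 2 := pow_le_pow_left₀ (frob_nonneg z) hzΛ 2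
      _ = 4 * Λ ^ 4 := by ring
  have hYΓ : Y ≤ 4 * Γ ^ 2 * S.card ^ 2 := by
    calc Y ≤ ∑ i ∈ S, ∑ j ∈ S, (2 * Γ) ^ 2 := Finset.sum_le_sum fun i _ =>
          Finset.sum_le_sum fun j _ => pow_le_pow_left₀ (hz0 i j) (hzΓ i j) 2
      _ = 4 * Γ ^ 2 * S.card ^ 2 := by simp; ring
  -- The two alternatives are the two terms of the minimum 𝓑: the Frobenius bound on `z` serves the
  -- first, the entrywise bound the second.
  have hθY : θ ^ 2 * Y ≤ R * S.card / 40 := by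
    rcases hB with h | h
    · have h1 : θ ^ 2 * Y ≤ θ ^ 2 * (4 * Λ ^ 4) := mul_le_mul_of_nonneg_left hYΛ (sq_nonneg θ)
      have h2 : R ≤ R * S.card := le_mul_of_one_le_right hR0 hs
      linarith
    · have h1 : θ ^ 2 * Y ≤ θ ^ 2 * (4 * Γ ^ 2 * S.card ^ 2) :=
        mul_le_mul_of_nonneg_left hYΓ (sq_nonneg θ)
      have h2 := mul_le_mul_of_nonneg_right h (by linarith : (0 : ℝ) ≤ S.card)
      linarith
  have htY : t ^ 2 * Y ≤ R * S.card / 10 := by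
    have h1 : t ^ 2 ≤ (2 * θ) ^ 2 := pow_le_pow_left₀ ht htθ 2
    have h2 := mul_le_mul_of_nonneg_right h1 hY0
    linarith
  -- (a + b)² ≤ (1 + ε)a² + (1 + 1/ε)b² with ε = 9/40. The total is then 2 · 49/40 + (49/9)/10 <
  -- 2.995.
  have hpt : ∀ i j, (t * adj (K b) i j + t ^ 2 * z i j) ^ 2 ≤
      t ^ 2 * (49 / 40 * adj (K b) i j + 49 / 9 * t ^ 2 * z i j ^ 2) := fun i j => by
    nth_rw 2 [← adj_sq]
    have h := mul_nonneg (sq_nonneg t) (sq_nonneg (9 * adj (K b) i j - 40 * (t * z i j)))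
    linarith
  calc ∑ i ∈ S, ∑ j ∈ S, (t * adj (K b) i j + t ^ 2 * z i j) ^ 2
      ≤ ∑ i ∈ S, ∑ j ∈ S, t ^ 2 * (49 / 40 * adj (K b) i j + 49 / 9 * t ^ 2 * z i j ^ 2) :=
        Finset.sum_le_sum fun i _ => Finset.sum_le_sum fun j _ => hpt i j
    _ = t ^ 2 * (49 / 40 * ∑ i ∈ S, ∑ j ∈ S, adj (K b) i j + 49 / 9 * (t ^ 2 * Y)) := by
        simp only [hY, Finset.mul_sum, ← Finset.sum_add_distrib]
        refine Finset.sum_congr rfl fun i _ => Finset.sum_congr rfl fun j _ => ?_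
        ring
    _ ≤ t ^ 2 * (2.995 * R * S.card) := by
        refine mul_le_mul_of_nonneg_left ?_ (sq_nonneg t)
        have : 0 ≤ R * S.card := mul_nonneg hR0 (by linarith)
        linarith

lemma mem_vert {G : SimpleGraph (Fin d)} {v : Fin d} : v ∈ vert G ↔ ∃ j, G.Adj v j := by
  simp [vert]

/-- Split vertices meet both colours, so they lie in `S`. Summing over i < j gives half the full
double sum, AM–GM separates the colours, and t² ≤ 4θ² gives 4 · 2.995 / 2 = 5.99, just below the 6
of the signal condition. -/
lemma sum_mixedCircuits_pairEdges_le (hθ : 0 ≤ θ)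
    (hΛ : ∀ b, frob (adj (K b)) ≤ Λ) (hΓ : ∀ b j, ∑ l, adj (K b) l j ≤ Γ)
    (h8Λ : 8 * θ * Λ ≤ 1) (h8Γ : 8 * θ * Γ ≤ 1) (hR0 : 0 ≤ R) {S : Finset (Fin d)}
    (hS : S = vert (K true) ∩ vert (K false))
    (hR : ∀ b, ∑ i ∈ S, ∑ j ∈ S, adj (K b) i j ≤ 2 * R * S.card)
    (hB : θ ^ 2 * (512 * Λ ^ 4) ≤ R ∨ θ ^ 2 * (160 * Γ ^ 2 * S.card) ≤ R) :
    ∑ C ∈ mixedCircuits Prod.snd Prod.fst (pairEdges K), Real.tanh (2 * θ) ^ C.card ≤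
      5.99 * θ ^ 2 * R * S.card := by
  set t := Real.tanh (2 * θ)
  have ht : 0 ≤ t := tanh_two_mul_nonneg hθ
  have htθ : t ≤ 2 * θ := tanh_le_self (by linarith)
  set u : Bool → Fin d → Fin d → ℝ := fun b i j =>
    t * adj (K b) i j + t ^ 2 * endMatrix t K b i j with hu
  have hu0 : ∀ b i j, 0 ≤ u b i j := fun b i j => add_nonneg (mul_nonneg ht (adj_nonneg _ _ _))
    (mul_nonneg (sq_nonneg t) (endMatrix_nonneg ht b i j))
  have husymm : ∀ b i j, u b i j = u b j i := fun b i j => by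
    simp only [hu]; rw [adj_comm, endMatrix_comm]
  have h1 : ∑ C ∈ mixedCircuits Prod.snd Prod.fst (pairEdges K), t ^ C.card ≤
      ∑ p ∈ (S ×ˢ S).filter (fun p => p.1 < p.2), u true p.1 p.2 * u false p.1 p.2 := by
    refine (sum_mixedCircuits_le ht (fun a ha => not_isDiag_of_mem_pairEdges ha) S ?_).trans
      (Finset.sum_le_sum fun p hp => ?_)
    · intro v hv
      have hvb : ∀ b, v ∈ vert (K b) := fun b => by
        obtain ⟨⟨c, e⟩, ha, rfl, l, hl⟩ := hv b
        rw [mem_pairEdges] at ha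
        simp only at ha hl
        rw [hl] at ha
        exact mem_vert.2 ⟨l, ha⟩
      rw [hS]
      exact Finset.mem_inter.2 ⟨hvb true, hvb false⟩
    · have hne : p.1 ≠ p.2 := ne_of_lt (Finset.mem_filter.1 hp).2
      exact mul_le_mul (endSum_pairEdges_le ht true hne) (endSum_pairEdges_le ht false hne)
        (endSum_nonneg ht) (hu0 _ _ _)
  have h2 := two_mul_sum_lt_le S (fun i j => u true i j * u false i j)
    (fun i j => mul_nonneg (hu0 _ _ _) (hu0 _ _ _))
    (fun i j => by simp only [husymm true i j, husymm false i j])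
  have h3 : ∑ i ∈ S, ∑ j ∈ S, u true i j * u false i j ≤
      ((∑ i ∈ S, ∑ j ∈ S, u true i j ^ 2) + ∑ i ∈ S, ∑ j ∈ S, u false i j ^ 2) / 2 := by
    rw [← Finset.sum_add_distrib, Finset.sum_div]
    refine Finset.sum_le_sum fun i _ => ?_
    rw [← Finset.sum_add_distrib, Finset.sum_div]
    refine Finset.sum_le_sum fun j _ => ?_
    linarith [two_mul_le_add_sq (u true i j) (u false i j)]
  have h4 : ∀ b, ∑ i ∈ S, ∑ j ∈ S, u b i j ^ 2 ≤ t ^ 2 * (2.995 * R * S.card) := fun b =>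
    sum_endBound_sq_le ht htθ b hΛ hΓ h8Λ h8Γ hR0 S (hR b) hB
  have h5 : t ^ 2 ≤ (2 * θ) ^ 2 := pow_le_pow_left₀ ht htθ 2
  have h6 : t ^ 2 * (2.995 * R * S.card) ≤ (2 * θ) ^ 2 * (2.995 * R * S.card) :=
    mul_le_mul_of_nonneg_right h5 (by positivity)
  linarith [h4 true, h4 false]

end Pair

/-! ### Quantities attached to a class of graphs -/

section GraphClass

variable {d : ℕ} {Gs : Finset (SimpleGraph (Fin d))} {G G' : SimpleGraph (Fin d)}

lemma frob_adj_le_Lam (hG : G ∈ Gs) : frob (adj G) ≤ Lam Gs :=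
  le_ciSup (f := fun G : Gs => frob (adj G.1)) (Set.finite_range _).bddAbove ⟨G, hG⟩

/-- Test the norm on the `j`-th unit vector. The supremum must be shown bounded, since an unbounded
one defaults to 0. -/
lemma sum_le_opNormOne (A : Matrix (Fin d) (Fin d) ℝ) (j : Fin d) :
    ∑ i, A i j ≤ opNormOne A := by
  have hv : ∑ i, |(Pi.single j 1 : Fin d → ℝ) i| = 1 := by
    rw [Finset.sum_eq_single j] <;> simp +contextual
  have hb : BddAbove (Set.range fun v : {v : Fin d → ℝ // ∑ i, |v i| = 1} =>
      ∑ i, |(A.mulVec v.1) i|) := by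
    refine ⟨∑ i, ∑ k, |A i k|, ?_⟩
    rintro _ ⟨⟨v, hv⟩, rfl⟩
    refine Finset.sum_le_sum fun i _ => ?_
    rw [show A.mulVec v i = ∑ k, A i k * v k from rfl]
    refine (Finset.abs_sum_le_sum_abs _ _).trans (Finset.sum_le_sum fun k _ => ?_)
    rw [abs_mul]
    refine mul_le_of_le_one_right (abs_nonneg _) ?_
    rw [← hv]
    exact Finset.single_le_sum (f := fun i => |v i|) (fun i _ => abs_nonneg _) (Finset.mem_univ k)
  refine le_trans (Finset.sum_le_sum fun i _ => ?_) (le_ciSup hb ⟨Pi.single j 1, hv⟩)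
  simp only [Matrix.mulVec_single_one]
  exact le_abs_self _

lemma sum_adj_le_Gam (hG : G ∈ Gs) (j : Fin d) : ∑ i, adj G i j ≤ Gam Gs :=
  (sum_le_opNormOne _ j).trans
    (le_ciSup (f := fun G : Gs => opNormOne (adj G.1)) (Set.finite_range _).bddAbove ⟨G, hG⟩)

lemma sum_adj_eq_two_mul_edgesWithin (G : SimpleGraph (Fin d)) (S : Finset (Fin d)) :
    ∑ i ∈ S, ∑ j ∈ S, adj G i j = 2 * edgesWithin G S := by
  classical
  have h := sum_adj_eq G fun e => if ∀ v ∈ e, v ∈ S then 1 else 0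
  have h1 : ∑ i, ∑ j, (if G.Adj i j then (if ∀ v ∈ s(i, j), v ∈ S then (1 : ℝ) else 0) else 0) =
      ∑ i ∈ S, ∑ j ∈ S, adj G i j := by
    rw [← Finset.sum_product', ← Finset.sum_product' S S (fun i j => adj G i j),
      Finset.univ_product_univ, ← Finset.sum_subset (Finset.subset_univ (S ×ˢ S))]
    · refine Finset.sum_congr rfl fun p hp => ?_
      have hp := Finset.mem_product.1 hp
      rw [adj_apply]
      simp [hp.1, hp.2]
    · intro p _ hp
      have : ¬ (p.1 ∈ S ∧ p.2 ∈ S) := fun h => hp (Finset.mem_product.2 h)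
      simp only [Sym2.mem_iff, forall_eq_or_imp, forall_eq, this, if_false, ite_self]
  rw [← h1, h, ← Finset.sum_filter, Finset.sum_const, nsmul_eq_mul, mul_one, edgesWithin,
    Set.ncard_eq_toFinset_card']
  congr 3
  ext e
  simp

lemma edgesWithin_le_arboricity (G : SimpleGraph (Fin d)) {S : Finset (Fin d)} (hS : 2 ≤ S.card) :
    (edgesWithin G S : ℝ) ≤ arboricity G * S.card := by
  have hs : (2 : ℝ) ≤ S.card := by exact_mod_cast hS
  have h1 : (edgesWithin G S : ℝ) / ((S.card : ℝ) - 1) ≤ arboricity G :=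
    (le_ciSup (f := fun V : {V : Finset (Fin d) // 2 ≤ V.card} =>
      (edgesWithin G V.1 : ℝ) / ((V.1.card : ℝ) - 1)) (Set.finite_range _).bddAbove ⟨S, hS⟩).trans
      (Nat.le_ceil _)
  rw [div_le_iff₀ (by linarith)] at h1
  have h2 : (0 : ℝ) ≤ arboricity G := Nat.cast_nonneg _
  linarith

lemma sum_adj_le_maxArboricity (hG : G ∈ Gs) (S : Finset (Fin d)) :
    ∑ i ∈ S, ∑ j ∈ S, adj G i j ≤ 2 * maxArboricity Gs * S.card := by
  classical
  -- Sets with fewer than two vertices are not covered by the arboricity, but contain no edges.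
  rcases lt_or_ge S.card 2 with hS | hS
  · have h0 : ∑ i ∈ S, ∑ j ∈ S, adj G i j = 0 :=
      Finset.sum_eq_zero fun i hi => Finset.sum_eq_zero fun j hj => by
        rw [Finset.card_le_one.1 (by omega) i hi j hj, adj_apply, if_neg (G.irrefl)]
    rw [h0]; positivity
  · rw [sum_adj_eq_two_mul_edgesWithin]
    have h1 : (arboricity G : ℝ) ≤ maxArboricity Gs := by
      exact_mod_cast Finset.le_sup (f := arboricity) hG
    have h2 := mul_le_mul_of_nonneg_right h1 (Nat.cast_nonneg S.card)
    linarith [edgesWithin_le_arboricity G hS]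

/-! ### Averages over a class of graphs -/

lemma unifExp_mono {φ ψ : SimpleGraph (Fin d) → ℝ} (h : ∀ G ∈ Gs, φ G ≤ ψ G) :
    unifExp Gs φ ≤ unifExp Gs ψ :=
  div_le_div_of_nonneg_right (Finset.sum_le_sum h) (Nat.cast_nonneg _)

lemma unifExp_const (hne : Gs.Nonempty) (c : ℝ) : unifExp Gs (fun _ => c) = c := by
  have : (Gs.card : ℝ) ≠ 0 := by exact_mod_cast hne.card_ne_zero
  simp [unifExp, mul_div_cancel_left₀ _ this]

lemma unifExp_add (φ ψ : SimpleGraph (Fin d) → ℝ) :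
    unifExp Gs (fun G => φ G + ψ G) = unifExp Gs φ + unifExp Gs ψ := by
  simp [unifExp, Finset.sum_add_distrib, add_div]

lemma unifExp_const_mul (c : ℝ) (φ : SimpleGraph (Fin d) → ℝ) :
    unifExp Gs (fun G => c * φ G) = c * unifExp Gs φ := by
  simp [unifExp, ← Finset.mul_sum, mul_div_assoc]

lemma sum_unifExp {ι : Type*} (s : Finset ι) (φ : ι → SimpleGraph (Fin d) → ℝ) :
    ∑ i ∈ s, unifExp Gs (φ i) = unifExp Gs fun G => ∑ i ∈ s, φ i G := by
  simp only [unifExp]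
  rw [← Finset.sum_div, Finset.sum_comm]

lemma unifExp_mul_unifExp (φ ψ : SimpleGraph (Fin d) → ℝ) :
    unifExp Gs φ * unifExp Gs ψ = unifExp Gs fun G => unifExp Gs fun G' => φ G * ψ G' := by
  simp only [unifExp_const_mul]
  rw [mul_comm, ← unifExp_const_mul]
  simp only [mul_comm]

lemma sum_ind (G : SimpleGraph (Fin d)) (I : Finset (Fin d)) :
    ∑ v ∈ I, ind v G = ((I ∩ vert G).card : ℝ) := by
  classical
  simp only [ind, Finset.sum_ite_mem, Finset.sum_const, nsmul_eq_mul, mul_one]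

/-- Negative association, applied to increasing exponentials, peels off one indicator at a time. For
a single indicator B, e^{cB} = 1 + (e^c − 1)B, and 1 + x ≤ e^x finishes. -/
lemma Incoherent.unifExp_exp_sum_le (hne : Gs.Nonempty) (h : Incoherent Gs) (hG : G ∈ Gs) {c : ℝ}
    (hc : 0 ≤ c) (I : Finset (Fin d)) (hI : I ⊆ vert G) :
    unifExp Gs (fun G' => Real.exp (c * ∑ v ∈ I, ind v G')) ≤
      Real.exp ((Real.exp c - 1) * unifExp Gs fun G' => ∑ v ∈ I, ind v G') := by
  classical
  induction I using Finset.induction_on with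
  | empty => simp [unifExp_const hne]
  | insert v I hv ih =>
    have hI' : I ⊆ vert G := (Finset.subset_insert v I).trans hI
    have hmono : ∀ J : Finset (Fin d), Monotone fun y : J → ℝ => Real.exp (c * ∑ u, y u) :=
      fun J y y' hy => Real.exp_le_exp.2
        (mul_le_mul_of_nonneg_left (Finset.sum_le_sum fun u _ => hy u) hc)
    have h1 := h G hG I {v} hI' (Finset.singleton_subset_iff.2 (hI (Finset.mem_insert_self v I)))
      (Finset.disjoint_singleton_right.2 hv) _ _ (hmono I) (hmono {v})
    have hsum : ∀ (J : Finset (Fin d)) (G' : SimpleGraph (Fin d)),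
        ∑ u : J, ind u.1 G' = ∑ u ∈ J, ind u G' := fun J G' =>
      Finset.sum_coe_sort J fun u => ind u G'
    simp only [hsum, Finset.sum_singleton] at h1
    have h2 : unifExp Gs (fun G' => Real.exp (c * ind v G')) ≤
        Real.exp ((Real.exp c - 1) * unifExp Gs fun G' => ind v G') := by
      have heq : ∀ G', Real.exp (c * ind v G') = 1 + (Real.exp c - 1) * ind v G' := fun G' => by
        unfold ind; split_ifs <;> simp
      simp only [heq]
      rw [unifExp_add, unifExp_const hne, unifExp_const_mul, add_comm]
      exact Real.add_one_le_exp _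
    have h3 : ∀ G', Real.exp (c * ∑ u ∈ insert v I, ind u G') =
        Real.exp (c * ∑ u ∈ I, ind u G') * Real.exp (c * ind v G') := fun G' => by
      rw [← Real.exp_add, Finset.sum_insert hv]; ring_nf
    simp only [h3]
    refine h1.trans ((mul_le_mul (ih hI') h2 ?_ (Real.exp_pos _).le).trans (le_of_eq ?_))
    · exact div_nonneg (Finset.sum_nonneg fun _ _ => (Real.exp_pos _).le) (Nat.cast_nonneg _)
    · rw [← Real.exp_add, ← mul_add, ← unifExp_add]
      simp only [Finset.sum_insert hv, add_comm]

lemma overlap_nonneg (Gs : Finset (SimpleGraph (Fin d))) : 0 ≤ overlap Gs :=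
  Real.iSup_nonneg fun _ =>
    div_nonneg (Finset.sum_nonneg fun _ _ => Nat.cast_nonneg _) (Nat.cast_nonneg _)

lemma Incoherent.unifExp_exp_card_le (hne : Gs.Nonempty) (h : Incoherent Gs) (hG : G ∈ Gs) {c : ℝ}
    (hc : 0 ≤ c) :
    unifExp Gs (fun G' => Real.exp (c * (vert G ∩ vert G').card)) ≤
      Real.exp (Real.exp c * overlap Gs) := by
  have h1 := h.unifExp_exp_sum_le hne hG hc (vert G) subset_rfl
  simp only [sum_ind] at h1
  refine h1.trans (Real.exp_le_exp.2 ?_)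
  have h2 : unifExp Gs (fun G' => ((vert G ∩ vert G').card : ℝ)) ≤ overlap Gs :=
    le_ciSup (f := fun G : Gs => unifExp Gs fun G' => ((vert G.1 ∩ vert G').card : ℝ))
      (Set.finite_range _).bddAbove ⟨G, hG⟩
  have h3 := overlap_nonneg Gs
  have h4 : 0 ≤ Real.exp c - 1 := sub_nonneg.2 (Real.one_le_exp hc)
  have h5 := mul_le_mul_of_nonneg_left h2 h4
  linarith

end GraphClass

/-! ### The minimax risk -/

section Risk

variable {d n : ℕ} {Θ : Matrix (Fin d) (Fin d) ℝ} {S : Set (Matrix (Fin d) (Fin d) ℝ)}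

lemma pmf_nonneg (Θ : Matrix (Fin d) (Fin d) ℝ) (x : Config d) : 0 ≤ pmf Θ x :=
  div_nonneg (weight_pos Θ x).le (partition_pos Θ).le

lemma sum_pmf (Θ : Matrix (Fin d) (Fin d) ℝ) : ∑ x, pmf Θ x = 1 := by
  simp only [pmf, ← Finset.sum_div]
  exact div_self (partition_pos Θ).ne'

lemma pmf_zero (x : Config d) : pmf 0 x = (2 ^ d)⁻¹ := by
  simp [pmf, partition, weight]

lemma sum_prod_pmf (n : ℕ) (Θ : Matrix (Fin d) (Fin d) ℝ) :
    ∑ X : Fin n → Config d, ∏ l, pmf Θ (X l) = 1 := by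
  rw [← Fintype.sum_pow, sum_pmf, one_pow]

lemma prob_nonneg (T : Set (Fin n → Config d)) : 0 ≤ prob n Θ T :=
  Finset.sum_nonneg fun _ _ => Set.indicator_nonneg
    (fun _ _ => Finset.prod_nonneg fun _ _ => pmf_nonneg _ _) _

lemma prob_le_one (T : Set (Fin n → Config d)) : prob n Θ T ≤ 1 := by
  classical
  rw [← sum_prod_pmf n Θ]
  refine Finset.sum_le_sum fun X _ => ?_
  rw [Set.indicator_apply]
  split_ifs
  · exact le_rfl
  · exact Finset.prod_nonneg fun _ _ => pmf_nonneg _ _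

lemma bddAbove_prob (n : ℕ) (S : Set (Matrix (Fin d) (Fin d) ℝ)) (T : Set (Fin n → Config d)) :
    BddAbove (Set.range fun Θ : S => prob n Θ.1 T) :=
  ⟨1, by rintro _ ⟨Θ, rfl⟩; exact prob_le_one T⟩

lemma risk_le_one (n : ℕ) (S : Set (Matrix (Fin d) (Fin d) ℝ)) : risk n S ≤ 1 := by
  have hb : BddBelow (Set.range fun ψ : (Fin n → Config d) → Bool =>
      prob n 0 {X | ψ X = true} + ⨆ Θ : S, prob n Θ.1 {X | ψ X = false}) :=
    ⟨0, by
      rintro _ ⟨ψ, rfl⟩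
      exact add_nonneg (prob_nonneg _) (Real.iSup_nonneg fun Θ => prob_nonneg _)⟩
  refine (ciInf_le hb fun _ => false).trans ?_
  have h0 : prob n (0 : Matrix (Fin d) (Fin d) ℝ) {X | false = true} = 0 := by
    simp [prob]
  rw [h0, zero_add]
  -- `zero_le_one` covers an empty parameter space, where the supremum is 0.
  exact Real.iSup_le (fun Θ => prob_le_one _) zero_le_one

lemma prob_true_add_prob_false (ψ : (Fin n → Config d) → Bool) :
    prob n Θ {X | ψ X = true} + prob n Θ {X | ψ X = false} = 1 := by
  rw [← sum_prod_pmf n Θ, prob, prob, ← Finset.sum_add_distrib]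
  refine Finset.sum_congr rfl fun X _ => ?_
  cases h : ψ X <;> simp [h]

/-- The total variation distance to the uniform distribution is controlled by the chi-square
divergence. -/
lemma sum_sub_le_sqrt {Ω : Type*} [Fintype Ω] [Nonempty Ω] {q : Ω → ℝ} {ε : ℝ}
    (hq : ∑ X, q X = 1) (h : (Fintype.card Ω : ℝ) * ∑ X, q X ^ 2 ≤ 1 + ε) (T : Finset Ω) :
    ∑ X ∈ T, ((Fintype.card Ω : ℝ)⁻¹ - q X) ≤ Real.sqrt ε := by
  set c : ℝ := (Fintype.card Ω : ℝ) with hc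
  have hc0 : c ≠ 0 := by simp [hc]
  refine Real.le_sqrt_of_sq_le ?_
  have h1 : (∑ X ∈ T, (c⁻¹ - q X)) ^ 2 ≤ (∑ X, |c⁻¹ - q X|) ^ 2 := by
    rw [← sq_abs]
    refine pow_le_pow_left₀ (abs_nonneg _) ?_ 2
    exact (Finset.abs_sum_le_sum_abs _ _).trans
      (Finset.sum_le_sum_of_subset_of_nonneg (Finset.subset_univ T) fun _ _ _ => abs_nonneg _)
  have h2 : (∑ X, |c⁻¹ - q X|) ^ 2 ≤ c * ∑ X, |c⁻¹ - q X| ^ 2 := by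
    simpa [hc] using sq_sum_le_card_mul_sum_sq (s := Finset.univ) (f := fun X => |c⁻¹ - q X|)
  -- The χ² divergence is the second moment of the likelihood ratio minus 1.
  have h3 : c * ∑ X, |c⁻¹ - q X| ^ 2 = c * ∑ X, q X ^ 2 - 1 := by
    simp only [sq_abs, sub_sq, Finset.sum_add_distrib, Finset.sum_sub_distrib, ← Finset.mul_sum, hq,
      Finset.sum_const, Finset.card_univ, nsmul_eq_mul, ← hc]
    field_simp
    ring
  linarith

variable {Gs : Finset (SimpleGraph (Fin d))} {θ ε : ℝ}

/-- The second moment of the likelihood ratio of a mixture against the uniform distribution. -/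
lemma card_mul_sum_sq_mixture (n : ℕ) (Gs : Finset (SimpleGraph (Fin d))) (θ : ℝ) :
    (Fintype.card (Fin n → Config d) : ℝ) *
      ∑ X : Fin n → Config d, (unifExp Gs fun G => ∏ l, pmf (θ • adj G) (X l)) ^ 2 =
    unifExp Gs fun G => unifExp Gs fun G' =>
      (2 ^ d * ∑ x, pmf (θ • adj G) x * pmf (θ • adj G') x) ^ n := by
  simp only [sq, unifExp_mul_unifExp]
  rw [sum_unifExp, ← unifExp_const_mul]
  congr 1; ext G
  rw [sum_unifExp, ← unifExp_const_mul]
  congr 1; ext G'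
  simp only [← Finset.prod_mul_distrib]
  rw [mul_pow, Fintype.sum_pow]
  simp

/-- Le Cam's method: the worst-case error dominates the average error under the uniform prior, and
total variation bounds how well any test separates the mixture from the null. -/
lemma one_sub_sqrt_le_risk (hne : Gs.Nonempty) (hS : ∀ G ∈ Gs, θ • adj G ∈ S)
    (h : (unifExp Gs fun G => unifExp Gs fun G' =>
      (2 ^ d * ∑ x, pmf (θ • adj G) x * pmf (θ • adj G') x) ^ n) ≤ 1 + ε) :
    1 - Real.sqrt ε ≤ risk n S := by
  classical
  refine le_ciInf fun ψ => ?_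
  set q : (Fin n → Config d) → ℝ := fun X => unifExp Gs fun G => ∏ l, pmf (θ • adj G) (X l) with hq
  have hq1 : ∑ X, q X = 1 := by
    simp only [hq, sum_unifExp, sum_prod_pmf, unifExp_const hne]
  have h1 := sum_sub_le_sqrt hq1 ((card_mul_sum_sq_mixture n Gs θ).le.trans h)
    (Finset.univ.filter fun X => ψ X = false)
  have h2 : unifExp Gs (fun G => prob n (θ • adj G) {X | ψ X = false}) ≤
      ⨆ Θ : S, prob n Θ.1 {X | ψ X = false} := by
    refine (unifExp_mono fun G hG => ?_).trans (unifExp_const hne _).le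
    exact le_ciSup (bddAbove_prob n S {X | ψ X = false}) ⟨_, hS G hG⟩
  have hind : ∀ Θ : Matrix (Fin d) (Fin d) ℝ, prob n Θ {X | ψ X = false} =
      ∑ X ∈ Finset.univ.filter (fun X => ψ X = false), ∏ l, pmf Θ (X l) := fun Θ => by
    rw [prob, Finset.sum_filter]
    exact Finset.sum_congr rfl fun X _ => by simp [Set.indicator_apply]
  have h3 : unifExp Gs (fun G => prob n (θ • adj G) {X | ψ X = false}) =
      ∑ X ∈ Finset.univ.filter (fun X => ψ X = false), q X := by
    simp only [hind, hq, sum_unifExp]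
  have h4 : prob n (0 : Matrix (Fin d) (Fin d) ℝ) {X | ψ X = false} =
      ∑ X ∈ Finset.univ.filter (fun X : Fin n → Config d => ψ X = false),
        (Fintype.card (Fin n → Config d) : ℝ)⁻¹ := by
    rw [hind]
    simp [pmf_zero]
  have h5 := prob_true_add_prob_false (Θ := 0) ψ
  rw [Finset.sum_sub_distrib, ← h3, ← h4] at h1
  linarith

end Risk

/-! ### From the signal conditions to the lower bound on the risk -/

section Main

variable {d n : ℕ} {Gs : Finset (SimpleGraph (Fin d))} {θ : ℝ}

lemma graphOf_smul_adj (hθ : 0 < θ) (G : SimpleGraph (Fin d)) : graphOf (θ • adj G) = G := by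
  classical
  ext i j
  have h : ∀ i j, (θ • adj G) i j ≠ 0 ↔ G.Adj i j := fun i j => by
    rw [Matrix.smul_apply, adj_apply]
    simp [hθ.ne']
  simp only [graphOf, SimpleGraph.fromRel_adj, h, G.adj_comm j i, or_self]
  exact ⟨fun h => h.2, fun h => ⟨h.ne, h⟩⟩

lemma smul_adj_mem_paramSpace {G₁ : Set (SimpleGraph (Fin d))} (hθ : 0 < θ)
    (h8 : 8 * θ * Lam Gs ≤ 1) {G : SimpleGraph (Fin d)} (hG : G ∈ Gs) (hG₁ : G ∈ G₁) :
    θ • adj G ∈ paramSpace G₁ θ := by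
  classical
  refine ⟨Matrix.IsSymm.ext fun i j => ?_, fun i => ?_, ?_, ?_, fun i j hij => ?_⟩
  · rw [Matrix.smul_apply, Matrix.smul_apply, adj_comm]
  · rw [Matrix.smul_apply, adj_apply, if_neg G.irrefl, smul_zero]
  · rwa [graphOf_smul_adj hθ]
  · rw [frob_smul, abs_of_pos hθ]
    have := mul_le_mul_of_nonneg_left (frob_adj_le_Lam hG) hθ.le
    linarith
  · rw [graphOf_smul_adj hθ] at hij
    rw [Matrix.smul_apply, adj_apply, if_pos hij, smul_eq_mul, mul_one]

/-- The signal strength conditions, cleared of denominators. -/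
structure WeakSignal (n : ℕ) (Gs : Finset (SimpleGraph (Fin d))) (θ : ℝ) : Prop where
  pos : 0 < θ
  max_le : 8 * θ * max (Lam Gs) (Gam Gs) ≤ 1
  sq_le : θ ^ 2 * (512 * Lam Gs ^ 4) ≤ maxArboricity Gs ∨
    θ ^ 2 * (160 * max (Lam Gs) (Gam Gs) ^ 2 * maxVert Gs) ≤ maxArboricity Gs
  overlap_pos : 0 < overlap Gs
  log_le : 6 * (n * θ ^ 2 * maxArboricity Gs) ≤ -Real.log (overlap Gs)

lemma sq_le_of_le_sqrt {a b : ℝ} (ha : 0 < a) (h : a ≤ Real.sqrt b) : 0 < b ∧ a ^ 2 ≤ b :=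
  have hb : 0 < b := Real.sqrt_pos.1 (ha.trans_le h)
  ⟨hb, by rwa [← Real.le_sqrt' ha]⟩

/-- Positivity of θ rules out every degenerate denominator: division by 0 and the logarithm at 0 are
0, so each such bound would force θ ≤ 0. -/
lemma WeakSignal.of_le (hpos : 0 < θ) (h₁ : θ ≤ 1 / (8 * max (Lam Gs) (Gam Gs)))
    (h₂ : θ ≤ Real.sqrt ((maxArboricity Gs : ℝ) / Bq Gs))
    (h₃ : θ ≤ Real.sqrt (Real.log (1 / overlap Gs) /
      (6 * (n : ℝ) * (maxArboricity Gs : ℝ)))) : WeakSignal n Gs θ := by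
  have hm : 0 < 8 * max (Lam Gs) (Gam Gs) := one_div_pos.1 (hpos.trans_le h₁)
  obtain ⟨hb, h₂⟩ := sq_le_of_le_sqrt hpos h₂
  obtain ⟨hl, h₃⟩ := sq_le_of_le_sqrt hpos h₃
  have hR : (0 : ℝ) ≤ maxArboricity Gs := Nat.cast_nonneg _
  have hn : (0 : ℝ) ≤ n := Nat.cast_nonneg _
  have hB : 0 < Bq Gs := by
    by_contra h
    exact absurd hb (not_lt.2 (div_nonpos_of_nonneg_of_nonpos hR (not_lt.1 h)))
  have hden : 0 < 6 * (n : ℝ) * (maxArboricity Gs : ℝ) := by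
    refine lt_of_le_of_ne (by positivity) fun h => ?_
    rw [← h, div_zero] at hl
    exact lt_irrefl _ hl
  rw [le_div_iff₀ hB] at h₂
  rw [le_div_iff₀ hden, one_div, Real.log_inv] at h₃
  refine ⟨hpos, ?_, ?_, ?_, by linarith⟩
  · rw [le_div_iff₀ hm] at h₁
    linarith
  · rw [Bq] at h₂
    rcases min_choice (512 * Lam Gs ^ 4)
      (160 * max (Lam Gs) (Gam Gs) ^ 2 * (maxVert Gs : ℝ)) with h | h
    · exact Or.inl (by rwa [h] at h₂)
    · exact Or.inr (by rwa [h] at h₂)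
  · refine lt_of_le_of_ne (overlap_nonneg Gs) fun h => ?_
    rw [← h] at hl
    simp at hl

lemma WeakSignal.sum_pmf_mul_pmf_le (h : WeakSignal n Gs θ) {G G' : SimpleGraph (Fin d)}
    (hG : G ∈ Gs) (hG' : G' ∈ Gs) :
    2 ^ d * ∑ x, pmf (θ • adj G) x * pmf (θ • adj G') x ≤
      Real.exp (5.99 * θ ^ 2 * maxArboricity Gs * (vert G ∩ vert G').card) := by
  set K : Bool → SimpleGraph (Fin d) := fun b => cond b G G'
  have hK : ∀ b, K b ∈ Gs := fun b => by cases b <;> assumption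
  refine (IsingDetection.sum_pmf_mul_pmf_le (K := K) h.pos.le).trans (Real.exp_le_exp.2 ?_)
  have hΛ : 8 * θ * Lam Gs ≤ 1 :=
    (mul_le_mul_of_nonneg_left (le_max_left _ _) (by linarith [h.pos])).trans h.max_le
  refine sum_mixedCircuits_pairEdges_le h.pos.le (Γ := max (Lam Gs) (Gam Gs))
    (fun b => frob_adj_le_Lam (hK b))
    (fun b j => (sum_adj_le_Gam (hK b) j).trans (le_max_right _ _)) hΛ h.max_le (Nat.cast_nonneg _)
    rfl (fun b => sum_adj_le_maxArboricity (hK b) _) (h.sq_le.imp_right fun h2 => le_trans ?_ h2)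
  have hc : ((vert G ∩ vert G').card : ℝ) ≤ maxVert Gs := by
    exact_mod_cast (Finset.card_le_card Finset.inter_subset_left).trans
      (Finset.le_sup (f := fun G => (vert G).card) hG)
  exact mul_le_mul_of_nonneg_left (mul_le_mul_of_nonneg_left hc (by positivity)) (sq_nonneg θ)

lemma WeakSignal.one_sub_le_risk (h : WeakSignal n Gs θ) (hne : Gs.Nonempty)
    (hinc : Incoherent Gs) {S : Set (Matrix (Fin d) (Fin d) ℝ)} (hS : ∀ G ∈ Gs, θ • adj G ∈ S) :
    1 - Real.sqrt (Real.exp (overlap Gs ^ (1 / 600 : ℝ)) - 1) ≤ risk n S := by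
  refine one_sub_sqrt_le_risk hne hS ?_
  rw [add_sub_cancel]
  set c : ℝ := 5.99 * (n * θ ^ 2 * maxArboricity Gs) with hc
  have hc0 : 0 ≤ c := by positivity
  -- The signal condition gives c ≤ (5.99/6) log(1/N), and 1 − 5.99/6 = 1/600.
  have hN : Real.exp c * overlap Gs ≤ overlap Gs ^ (1 / 600 : ℝ) := by
    rw [Real.rpow_def_of_pos h.overlap_pos]
    nth_rw 1 [← Real.exp_log h.overlap_pos]
    rw [← Real.exp_add, Real.exp_le_exp]
    linarith [h.log_le]
  refine (unifExp_mono fun G hG => ?_).trans (unifExp_const hne _).le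
  refine le_trans (unifExp_mono fun G' hG' => ?_)
    ((hinc.unifExp_exp_card_le hne hG hc0).trans (Real.exp_le_exp.2 hN))
  have h0 : 0 ≤ 2 ^ d * ∑ x, pmf (θ • adj G) x * pmf (θ • adj G') x :=
    mul_nonneg (by positivity)
      (Finset.sum_nonneg fun x _ => mul_nonneg (pmf_nonneg _ x) (pmf_nonneg _ x))
  refine (pow_le_pow_left₀ h0 (h.sum_pmf_mul_pmf_le hG hG') n).trans (le_of_eq ?_)
  rw [← Real.exp_nat_mul, hc]
  ring_nf

end Main

end IsingDetection

open IsingDetection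
theorem mainTheorem1 (d : ℕ → ℕ)
    (G₁ : ∀ n : ℕ, Set (SimpleGraph (Fin (d n))))
    (Gs : ∀ n : ℕ, Finset (SimpleGraph (Fin (d n))))
    (θ : ℕ → ℝ)
    (hbot : ∀ᶠ n in atTop, (⊥ : SimpleGraph (Fin (d n))) ∉ G₁ n)
    (hsub : ∀ᶠ n in atTop, ∀ G ∈ Gs n, G ∈ G₁ n)
    (hne : ∀ᶠ n in atTop, (Gs n).Nonempty)
    (hinc : ∀ᶠ n in atTop, Incoherent (Gs n))
    (hN : Tendsto (fun n => overlap (Gs n)) atTop (𝓝 0))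
    (hpos : ∀ᶠ n in atTop, 0 < θ n)
    (h₁ : ∀ᶠ n in atTop, θ n ≤ 1 / (8 * max (Lam (Gs n)) (Gam (Gs n))))
    (h₂ : ∀ᶠ n in atTop, θ n ≤ Real.sqrt ((maxArboricity (Gs n) : ℝ) / Bq (Gs n)))
    (h₃ : ∀ᶠ n in atTop, θ n ≤
      Real.sqrt (Real.log (1 / overlap (Gs n)) / (6 * (n : ℝ) * (maxArboricity (Gs n) : ℝ)))) :
    Tendsto (fun n => risk n (paramSpace (G₁ n) (θ n))) atTop (𝓝 1) ∧
      Tendsto (fun n => risk n (simpleSpace (Gs n) (θ n))) atTop (𝓝 1) := by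
  have hlim : Tendsto (fun n => 1 - Real.sqrt (Real.exp (overlap (Gs n) ^ (1 / 600 : ℝ)) - 1))
      atTop (𝓝 1) := by
    have hcont : ContinuousAt
        (fun x : ℝ => 1 - Real.sqrt (Real.exp (x ^ (1 / 600 : ℝ)) - 1)) 0 :=
      continuousAt_const.sub (((Real.continuous_exp.continuousAt.comp
        (Real.continuousAt_rpow_const 0 _ (Or.inr (by norm_num)))).sub continuousAt_const).sqrt)
    have h := hcont.tendsto.comp hN
    rwa [Real.zero_rpow (by norm_num), Real.exp_zero, sub_self, Real.sqrt_zero, sub_zero] at h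
  have hw : ∀ᶠ n in atTop, WeakSignal n (Gs n) (θ n) := by
    filter_upwards [hpos, h₁, h₂, h₃] with n h0 h1 h2 h3
    exact WeakSignal.of_le h0 h1 h2 h3
  constructor
  · refine tendsto_of_tendsto_of_tendsto_of_le_of_le' hlim tendsto_const_nhds ?_
      (Eventually.of_forall fun n => risk_le_one n _)
    filter_upwards [hw, hne, hinc, hsub] with n hwn hnen hincn hsubn
    refine hwn.one_sub_le_risk hnen hincn fun G hG => ?_
    exact smul_adj_mem_paramSpace hwn.pos ((mul_le_mul_of_nonneg_left (le_max_left _ _)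
      (by linarith [hwn.pos])).trans hwn.max_le) hG (hsubn G hG)
  · refine tendsto_of_tendsto_of_tendsto_of_le_of_le' hlim tendsto_const_nhds ?_
      (Eventually.of_forall fun n => risk_le_one n _)
    filter_upwards [hw, hne, hinc] with n hwn hnen hincn
    exact hwn.one_sub_le_risk hnen hincn fun G hG => ⟨G, hG, rfl⟩
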